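/- Write $u^g=g^{-1}ug$ and $(u,v)=u^{-1}v^{-1}uv$. Let $p$ be an odd prime, $n>1$, $y=p^n$, $z=p^{n-1}$, $z_1=p^{n-2}$. Let $C_m$ be the cyclic group of order $m$, let $P,Q$ be the standard generators of $C_y\times C_p$ (of orders $y$ and $p$), and let $\mathrm{Hol}(A)=A\rtimes\mathrm{Aut}(A)$. Let $Qf(p)$ be the nonabelian group of order $p^3$ and exponent $p$, with generators $a,b,c$ such that $a$ is central and $b^c=ab$. For $C_z=\langle f\rangle$, let $Y$ denote the central product with the amalgamation $a=f^{z_1}$. Let $s,t,x,\alpha,y_d,y_e$ be integers such that $s$ has multiplicative order $p-1$ modulo $p$; $t\equiv s^{p-2}\pmod p$; $x$ has multiplicative order $p-1$ modulo $p^n$; $\alpha$ has multiplicative order $p^{n-1}$ modulo $p^n$, with $\alpha^{p^{n-2}}\equiv (p-1)p^{n-1}+1 \pmod{p^n}$; $y_d\equiv -t \pmod p$; $y_e\equiv x\pmod p$. Such integers exist; for $p=3$ one may take $s=t=x=y_e=-1$ and $y_d=1$ (with a suitable $\alpha$). For every such choice the following hold. 1. $\mathrm{Aut}(C_y\times C_p)$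 has generators $a,b,c,d,e,f$ for which the following is a presentation: $$a^p=b^p=c^p=(a,b)=(a,c)=b^c a^{-1}b^{-1}=f^z=(a,f)=(b,f)=(c,f)=a f^{-z_1}=1,$$ $$d^{p-1}=(a,d)=b^d b^{-s}=c^d c^{-t}=(d,f)=e^{p-1}=(a,e)=(b,e)=(c,e)=(d,e)=(e,f)=1.$$ With respect to these generators it is isomorphic to $$\bigl([Qf(p)\,Y\,C_z]\rtimes C_{p-1}\bigr)\times C_{p-1}\qquad\text{and to}\qquad \bigl([Qf(p)\rtimes C_{p-1}]\,Y\,C_z\bigr)\times C_{p-1},$$ where $Qf(p)=\langle a,b,c\rangle$, $C_z=\langle f\rangle$, the first $C_{p-1}=\langle d\rangle$ acts by $a^d=a$, $b^d=b^s$, $c^d=c^t$ (and $f^d=f$), and the last $C_{p-1}=\langle e\rangle$. 2. These generators act on $C_y\times C_p$ (as a right action) by $$\begin{array}{c|cccccc} & a&b&c&d&e&f\\\hline P& P^{(p-1)p^{n-1}+1}&P&PQ&P^{-1}&P^x&P^{\alpha}\\ Q&Q&P^{p^{n-1}}Q&Q&Q^{y_d}&Q^{y_e}&Q\end{array}$$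 3. $\mathrm{Hol}(C_y\times C_p)$ is presented by the generators $P,Q,a,b,c,d,e,f$ with the relations $P^y=Q^p=(P,Q)=1$, the relations in 1, and the relations that equate $P^g$ and $Q^g$, for $g\in\{a,b,c,d,e,f\}$, with the entries of the table in 2; here $P,Q$ correspond to the given generators of $C_y\times C_p$, and $a,\dots,f$ to the automorphisms in 1 and 2. -/

import Mathlib

namespace HolAbelian

/-- The cyclic group of order `m` (for `m ≥ 1`), written multiplicatively. -/
abbrev Cyc (m : ℕ) : Type := Multiplicative (ZMod m)

/-- The standard generator of `Cyc m`. -/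
def Cyc.gen (m : ℕ) : Cyc m := Multiplicative.ofAdd 1

/-- `Qf(p)`: the nonabelian group of order `p ^ 3` and exponent `p` (for `p` an odd prime), realised
as the group of unitriangular `3 × 3` matrices with rows `(1, x, z)`, `(0, 1, y)`, `(0, 0, 1)`
over `ZMod p`. -/
@[ext]
structure Qf (p : ℕ) : Type where
  x : ZMod p
  y : ZMod p
  z : ZMod p

namespace Qf

variable {p : ℕ}

instance : Mul (Qf p) := ⟨fun g h => ⟨g.x + h.x, g.y + h.y, g.z + h.z + g.x * h.y⟩⟩
instance : One (Qf p) := ⟨⟨0, 0, 0⟩⟩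
instance : Inv (Qf p) := ⟨fun g => ⟨-g.x, -g.y, -g.z + g.x * g.y⟩⟩

@[simp] theorem mul_x (g h : Qf p) : (g * h).x = g.x + h.x := rfl
@[simp] theorem mul_y (g h : Qf p) : (g * h).y = g.y + h.y := rfl
@[simp] theorem mul_z (g h : Qf p) : (g * h).z = g.z + h.z + g.x * h.y := rfl
@[simp] theorem one_x : (1 : Qf p).x = 0 := rfl
@[simp] theorem one_y : (1 : Qf p).y = 0 := rfl
@[simp] theorem one_z : (1 : Qf p).z = 0 := rfl
@[simp] theorem inv_x (g : Qf p) : (g⁻¹).x = -g.x := rfl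
@[simp] theorem inv_y (g : Qf p) : (g⁻¹).y = -g.y := rfl
@[simp] theorem inv_z (g : Qf p) : (g⁻¹).z = -g.z + g.x * g.y := rfl

instance : Group (Qf p) :=
  Group.ofLeftAxioms
    (fun g h k => by ext <;> simp <;> ring)
    (fun g => by ext <;> simp)
    (fun g => by ext <;> simp)

/-- The central generator `a`. -/
def a (p : ℕ) : Qf p := ⟨0, 0, 1⟩
/-- The generator `b`. -/
def b (p : ℕ) : Qf p := ⟨1, 0, 0⟩
/-- The generator `c`; one has `c⁻¹ * b * c = b * a`. -/
def c (p : ℕ) : Qf p := ⟨0, 1, 0⟩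

end Qf

/-- The central product `G Y H` in which the central element `g` of `G` is identified with the
central element `h` of `H` (used only for `g`, `h` central and of the same order). -/
abbrev CentralProduct {G H : Type} [Group G] [Group H] (g : G) (h : H) : Type :=
  (G × H) ⧸ Subgroup.normalClosure ({(g, h⁻¹)} : Set (G × H))

/-- The canonical map from the left factor to a central product. -/
def CentralProduct.left {G H : Type} [Group G] [Group H] (g : G) (h : H) :
    G →* CentralProduct g h :=
  (QuotientGroup.mk' _).comp (MonoidHom.inl G H)

/-- The canonical map from the right factor to a central product. -/
def CentralProduct.right {G H : Type} [Group G] [Group H] (g : G) (h : H) :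
    H →* CentralProduct g h :=
  (QuotientGroup.mk' _).comp (MonoidHom.inr G H)

/-- `Qf(p) Y C_z` with `z = p ^ (n - 1)`: the centre of `Qf(p)` is amalgamated with the subgroup of
order `p` of `C_z`, by `a = f ^ (p ^ (n - 2))`. -/
abbrev QfYC (p n : ℕ) : Type :=
  CentralProduct (Qf.a p) (Cyc.gen (p ^ (n - 1)) ^ (p ^ (n - 2)))

namespace QfYC

/-- The image of `a` in `Qf(p) Y C_z`. -/
def a (p n : ℕ) : QfYC p n := CentralProduct.left _ _ (Qf.a p)
/-- The image of `b` in `Qf(p) Y C_z`. -/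
def b (p n : ℕ) : QfYC p n := CentralProduct.left _ _ (Qf.b p)
/-- The image of `c` in `Qf(p) Y C_z`. -/
def c (p n : ℕ) : QfYC p n := CentralProduct.left _ _ (Qf.c p)
/-- The image in `Qf(p) Y C_z` of the generator `f` of `C_z`. -/
def f (p n : ℕ) : QfYC p n := CentralProduct.right _ _ (Cyc.gen (p ^ (n - 1)))

end QfYC

/-- The action of the generator `d` of `C_{p-1}` on `Qf(p)` defining the semidirect product:
`a ^ d = a`, `b ^ d = b ^ s`, `c ^ d = c ^ t`. In a semidirect product with action `ψ`, the conjugate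
`d⁻¹ * u * d` is `(ψ d)⁻¹ u`. -/
structure IsQfAction (p : ℕ) (s t : ℤ) (ψ : Cyc (p - 1) →* MulAut (Qf p)) : Prop where
  map_a : (ψ (Cyc.gen (p - 1)))⁻¹ (Qf.a p) = Qf.a p
  map_b : (ψ (Cyc.gen (p - 1)))⁻¹ (Qf.b p) = Qf.b p ^ s
  map_c : (ψ (Cyc.gen (p - 1)))⁻¹ (Qf.c p) = Qf.c p ^ t

/-- The action of the generator `d` of `C_{p-1}` on `Qf(p) Y C_z` defining the semidirect product:
`a ^ d = a`, `b ^ d = b ^ s`, `c ^ d = c ^ t`, `f ^ d = f`. -/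
structure IsQfYCAction (p n : ℕ) (s t : ℤ) (φ : Cyc (p - 1) →* MulAut (QfYC p n)) : Prop where
  map_a : (φ (Cyc.gen (p - 1)))⁻¹ (QfYC.a p n) = QfYC.a p n
  map_b : (φ (Cyc.gen (p - 1)))⁻¹ (QfYC.b p n) = QfYC.b p n ^ s
  map_c : (φ (Cyc.gen (p - 1)))⁻¹ (QfYC.c p n) = QfYC.c p n ^ t
  map_f : (φ (Cyc.gen (p - 1)))⁻¹ (QfYC.f p n) = QfYC.f p n

/-- `(Qf(p) ⋊ C_{p-1}) Y C_z` with `z = p ^ (n - 1)` and the same amalgamation. -/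
abbrev QfCYC (p n : ℕ) (ψ : Cyc (p - 1) →* MulAut (Qf p)) : Type :=
  CentralProduct (SemidirectProduct.inl (Qf.a p) : Qf p ⋊[ψ] Cyc (p - 1))
    (Cyc.gen (p ^ (n - 1)) ^ (p ^ (n - 2)))

/-- The group `C_y × C_p` with `y = p ^ n`. -/
abbrev CyCp (p n : ℕ) : Type := Cyc (p ^ n) × Cyc p

/-- The generator of the factor `C_y`. -/
def CyCp.P (p n : ℕ) : CyCp p n := (Cyc.gen (p ^ n), 1)

/-- The generator of the factor `C_p`. -/
def CyCp.Q (p n : ℕ) : CyCp p n := (1, Cyc.gen p)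

/-- The holomorph `A ⋊ Aut(A)`. -/
abbrev Hol (A : Type) [Group A] : Type := A ⋊[MonoidHom.id (MulAut A)] MulAut A

/-- The conjugate `g ^ h = h⁻¹ * g * h`. -/
def conjBy {G : Type} [Group G] (g h : G) : G := h⁻¹ * g * h

/-- The commutator `g⁻¹ * h⁻¹ * g * h`. -/
def comm {G : Type} [Group G] (g h : G) : G := g⁻¹ * h⁻¹ * g * h

/-- The generators in the presentation of the automorphism group. -/
inductive AutGen : Type
  | a | b | c | d | e | f

/-- The generators `a, …, f` as elements of `((Qf(p) Y C_z) ⋊ C_{p-1}) × C_{p-1}`. -/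
def gensOne (p n : ℕ) (φ : Cyc (p - 1) →* MulAut (QfYC p n)) :
    AutGen → (QfYC p n ⋊[φ] Cyc (p - 1)) × Cyc (p - 1)
  | .a => (SemidirectProduct.inl (QfYC.a p n), 1)
  | .b => (SemidirectProduct.inl (QfYC.b p n), 1)
  | .c => (SemidirectProduct.inl (QfYC.c p n), 1)
  | .d => (SemidirectProduct.inr (Cyc.gen (p - 1)), 1)
  | .e => (1, Cyc.gen (p - 1))
  | .f => (SemidirectProduct.inl (QfYC.f p n), 1)

/-- The generators `a, …, f` as elements of `((Qf(p) ⋊ C_{p-1}) Y C_z) × C_{p-1}`. -/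
def gensTwo (p n : ℕ) (ψ : Cyc (p - 1) →* MulAut (Qf p)) :
    AutGen → QfCYC p n ψ × Cyc (p - 1)
  | .a => (CentralProduct.left _ _ (SemidirectProduct.inl (Qf.a p)), 1)
  | .b => (CentralProduct.left _ _ (SemidirectProduct.inl (Qf.b p)), 1)
  | .c => (CentralProduct.left _ _ (SemidirectProduct.inl (Qf.c p)), 1)
  | .d => (CentralProduct.left _ _ (SemidirectProduct.inr (Cyc.gen (p - 1))), 1)
  | .e => (1, Cyc.gen (p - 1))
  | .f => (CentralProduct.right _ _ (Cyc.gen (p ^ (n - 1))), 1)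

/-- The generators in the presentation of the holomorph. -/
inductive HolGen : Type
  | P | Q
  | aut (g : AutGen)

/-- The relators of the presentation of `Aut(C_y × C_p)`, `y = p ^ n`. -/
def autRels (p n : ℕ) (s t : ℤ) : Set (FreeGroup AutGen) :=
  let a := FreeGroup.of AutGen.a
  let b := FreeGroup.of AutGen.b
  let c := FreeGroup.of AutGen.c
  let d := FreeGroup.of AutGen.d
  let e := FreeGroup.of AutGen.e
  let f := FreeGroup.of AutGen.f
  { a ^ p, b ^ p, c ^ p, comm a b, comm a c, conjBy b c * a⁻¹ * b⁻¹,
    f ^ (p ^ (n - 1)), comm a f, comm b f, comm c f, a * (f ^ (p ^ (n - 2)))⁻¹,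
    d ^ (p - 1), comm a d, conjBy b d * b ^ (-s), conjBy c d * c ^ (-t), comm d f,
    e ^ (p - 1), comm a e, comm b e, comm c e, comm d e, comm e f }

/-- The relators of the presentation of `Hol(C_y × C_p)`, `y = p ^ n`: those of `C_y × C_p`, those
of `Aut(C_y × C_p)`, and the action of the generators of the latter on those of the former. -/
def holRels (p n : ℕ) (s t x af yd ye : ℤ) : Set (FreeGroup HolGen) :=
  let P := FreeGroup.of HolGen.P
  let Q := FreeGroup.of HolGen.Q
  let a := FreeGroup.of (HolGen.aut AutGen.a)
  let b := FreeGroup.of (HolGen.aut AutGen.b)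
  let c := FreeGroup.of (HolGen.aut AutGen.c)
  let d := FreeGroup.of (HolGen.aut AutGen.d)
  let e := FreeGroup.of (HolGen.aut AutGen.e)
  let f := FreeGroup.of (HolGen.aut AutGen.f)
  (FreeGroup.map HolGen.aut '' autRels p n s t) ∪
  { P ^ (p ^ n), Q ^ p, comm P Q,
    conjBy P a * (P ^ ((p - 1) * p ^ (n - 1) + 1))⁻¹, conjBy Q a * Q⁻¹,
    conjBy P b * P⁻¹, conjBy Q b * (P ^ (p ^ (n - 1)) * Q)⁻¹,
    conjBy P c * (P * Q)⁻¹, conjBy Q c * Q⁻¹,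
    conjBy P d * P, conjBy Q d * Q ^ (-yd),
    conjBy P e * P ^ (-x), conjBy Q e * Q ^ (-ye),
    conjBy P f * P ^ (-af), conjBy Q f * Q⁻¹ }

/-- The numerical parameters of the presentations: `s` is a primitive `(p - 1)`-th root of unity
modulo `p` and `t ≡ s ^ (p - 2)`; `x` is a primitive `(p - 1)`-th root of unity modulo `p ^ n`;
`af` is a primitive `p ^ (n - 1)`-th root of unity modulo `p ^ n`, normalised so that the action of
`f ^ (p ^ (n - 2))` is that of `a`; `yd`, `ye` are the `(p - 1)`-th roots of unity modulo `p` by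
which `d`, `e` act on `C_p`. -/
structure IsParam (p n : ℕ) (s t x af yd ye : ℤ) : Prop where
  s_order : orderOf (s : ZMod p) = p - 1
  t_eq : (t : ZMod p) = (s : ZMod p) ^ (p - 2)
  x_order : orderOf (x : ZMod (p ^ n)) = p - 1
  af_order : orderOf (af : ZMod (p ^ n)) = p ^ (n - 1)
  af_pow : (af : ZMod (p ^ n)) ^ (p ^ (n - 2)) = (((p - 1) * p ^ (n - 1) + 1 : ℕ) : ZMod (p ^ n))
  yd_eq : (yd : ZMod p) = -(t : ZMod p)
  ye_eq : (ye : ZMod p) = (x : ZMod p)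

/-- The table of the action of the generators on `P` and `Q`. A group element `g` acts on
`C_y × C_p` from the right, by `u ^ g = (Φ g)⁻¹ u`; this is conjugation `g⁻¹ * u * g` in the
holomorph. -/
structure IsTable (p n : ℕ) (x af yd ye : ℤ) (φ : AutGen → MulAut (CyCp p n)) : Prop where
  P_a : (φ AutGen.a)⁻¹ (CyCp.P p n) = CyCp.P p n ^ ((p - 1) * p ^ (n - 1) + 1)
  Q_a : (φ AutGen.a)⁻¹ (CyCp.Q p n) = CyCp.Q p n
  P_b : (φ AutGen.b)⁻¹ (CyCp.P p n) = CyCp.P p n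
  Q_b : (φ AutGen.b)⁻¹ (CyCp.Q p n) = CyCp.P p n ^ (p ^ (n - 1)) * CyCp.Q p n
  P_c : (φ AutGen.c)⁻¹ (CyCp.P p n) = CyCp.P p n * CyCp.Q p n
  Q_c : (φ AutGen.c)⁻¹ (CyCp.Q p n) = CyCp.Q p n
  P_d : (φ AutGen.d)⁻¹ (CyCp.P p n) = (CyCp.P p n)⁻¹
  Q_d : (φ AutGen.d)⁻¹ (CyCp.Q p n) = CyCp.Q p n ^ yd
  P_e : (φ AutGen.e)⁻¹ (CyCp.P p n) = CyCp.P p n ^ x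
  Q_e : (φ AutGen.e)⁻¹ (CyCp.Q p n) = CyCp.Q p n ^ ye
  P_f : (φ AutGen.f)⁻¹ (CyCp.P p n) = CyCp.P p n ^ af
  Q_f : (φ AutGen.f)⁻¹ (CyCp.Q p n) = CyCp.Q p n

end HolAbelian

open HolAbelian

/-! Write `C_y × C_p` additively. An endomorphism is a matrix `(u, v; w, k)` with `u` modulo `p ^ n`
and `v`, `w`, `k` modulo `p`, where `v` enters through the embedding of `ZMod p` as the multiples of
`p ^ (n - 1)` (`exists_eq_endo`). As `1 < n`, these multiples square to zero and vanish modulo `p`.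
So an automorphism is a matrix with `u` and `k` units, and it factors uniquely into a diagonal, an
upper and a lower elementary matrix.

The elementary matrices are `b` and `c`, and their commutator is the diagonal matrix with entries `1
- p ^ (n - 1)` and `1`, which is `a`, a power of `f = (α, 1)`. The diagonal matrices `e` and `f`
have equal entries modulo `p` and hence are central; `d = (-1, -s⁻¹)` scales `b` by `s` and `c` by
`s⁻¹`.

The presentation is first identified with both explicit products, by universal properties in both
directions (`exists_equiv_gensOne`, `exists_equiv_gensTwo`). The first identification yields the
normal form `c ^ j * b ^ i * f ^ k * d ^ l * e ^ m`. Mapping it to matrices gives injectivity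
(`autHom_injective`): a trivial matrix forces each exponent to be divisible by the order of its
generator. For surjectivity (`autHom_surjective`), `d`, `e`, `f` must generate all diagonal
matrices: `s` adjusts the ratio of the entries modulo `p`, `x` adjusts the second entry, and `α`
generates the units congruent to `1`. The holomorph is then the semidirect product of two presented
groups with the action given on generators (`exists_equiv_hol`). -/

namespace HolAbelian

/-! ### Homomorphisms out of cyclic groups. -/

section Cyclic

variable {G : Type} [Group G] {m : ℕ}

/-- The homomorphism from `Cyc m` that sends the generator to an element `g` with `g ^ m = 1`. -/
def cycLift (m : ℕ) (g : G) (hg : g ^ m = 1) : Cyc m →* G :=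
  AddMonoidHom.toMultiplicativeLeft
    (ZMod.lift m ⟨zmultiplesHom (Additive G) (Additive.ofMul g), by
      rw [zmultiplesHom_apply, natCast_zsmul, ← ofMul_pow, hg, ofMul_one]⟩)

theorem cycLift_ofAdd_intCast (g : G) (hg : g ^ m = 1) (k : ℤ) :
    cycLift m g hg (Multiplicative.ofAdd (k : ZMod m)) = g ^ k := by
  have h := ZMod.lift_coe m (A := Additive G)
    ⟨zmultiplesHom (Additive G) (Additive.ofMul g), by
      rw [zmultiplesHom_apply, natCast_zsmul, ← ofMul_pow, hg, ofMul_one]⟩ k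
  simp only [zmultiplesHom_apply, ← ofMul_zpow] at h
  exact congrArg Additive.toMul h

theorem cyc_eq_gen_zpow (x : Cyc m) : ∃ k : ℤ, x = Cyc.gen m ^ k := by
  obtain ⟨k, hk⟩ := ZMod.intCast_surjective (Multiplicative.toAdd x)
  refine ⟨k, ?_⟩
  rw [Cyc.gen, ← ofAdd_zsmul, zsmul_one, hk, ofAdd_toAdd]

theorem cyc_gen_pow (m : ℕ) : Cyc.gen m ^ m = 1 := by
  rw [Cyc.gen, ← ofAdd_nsmul, nsmul_one, ZMod.natCast_self, ofAdd_zero]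

theorem cyc_gen_pow_eq_ofAdd (m k : ℕ) : Cyc.gen m ^ k = Multiplicative.ofAdd (k : ZMod m) := by
  rw [Cyc.gen, ← ofAdd_nsmul, nsmul_one]

theorem cyc_gen_zpow_eq_ofAdd (m : ℕ) (k : ℤ) :
    Cyc.gen m ^ k = Multiplicative.ofAdd (k : ZMod m) := by
  rw [Cyc.gen, ← ofAdd_zsmul, zsmul_one]

@[simp]
theorem cycLift_gen (g : G) (hg : g ^ m = 1) : cycLift m g hg (Cyc.gen m) = g := by
  have := cycLift_ofAdd_intCast g hg 1
  rwa [Int.cast_one, zpow_one] at this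

theorem closure_cyc_gen (m : ℕ) : Subgroup.closure {Cyc.gen m} = ⊤ := by
  rw [eq_top_iff]
  rintro x -
  obtain ⟨k, rfl⟩ := cyc_eq_gen_zpow x
  exact Subgroup.zpow_mem _ (Subgroup.subset_closure (Set.mem_singleton _)) k

theorem cyc_hom_ext {M : Type} [Monoid M] {F F' : Cyc m →* M}
    (h : F (Cyc.gen m) = F' (Cyc.gen m)) : F = F' := by
  refine MonoidHom.eq_of_eqOn_dense (closure_cyc_gen m) fun x hx => ?_
  rw [Set.mem_singleton_iff.1 hx, h]

/-- An element commuting with `g` commutes with the image of `cycLift m g`. -/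
theorem commute_cycLift {u g : G} (hg : g ^ m = 1) (h : Commute u g) (y : Cyc m) :
    Commute u (cycLift m g hg y) := by
  obtain ⟨k, rfl⟩ := cyc_eq_gen_zpow y
  rw [map_zpow, cycLift_gen]
  exact h.zpow_right k

end Cyclic

/-! ### Homomorphisms out of semidirect products. -/

section Semidirect

variable {N G K : Type} [Group N] [Group G] [Group K]

/-- The compatibility condition of `SemidirectProduct.lift` need only be checked on generators. -/
theorem semidirect_compat {φ : G →* MulAut N} (fn : N →* K) (fg : G →* K) {S : Set G}
    (hS : Subgroup.closure S = ⊤)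
    (h : ∀ g ∈ S, ∀ x, fn ((φ g)⁻¹ x) = (fg g)⁻¹ * fn x * fg g) (g : G) :
    fn.comp (φ g).toMonoidHom = (MulAut.conj (fg g)).toMonoidHom.comp fn := by
  have key : ∀ x, fn (φ g x) = fg g * fn x * (fg g)⁻¹ := by
    -- The elements `g` that satisfy the identity form a subgroup.
    have hg : g ∈ Subgroup.closure S := hS ▸ Subgroup.mem_top g
    induction hg using Subgroup.closure_induction with
    | mem g hg =>
      intro x
      have := h g hg (φ g x)
      rw [MulAut.inv_apply_self] at this
      rw [this]; group
    | one => intro x; simp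
    | mul g g' _ _ hg hg' =>
      intro x
      rw [map_mul, MulAut.mul_apply, hg, hg', map_mul]; group
    | inv g _ hg =>
      intro x
      have := hg ((φ g)⁻¹ x)
      rw [MulAut.apply_inv_self] at this
      rw [map_inv, this, map_inv]; group
  ext x
  simpa using key x

end Semidirect

/-! ### The universal property of the central product. -/

namespace CentralProduct

variable {G H K : Type} [Group G] [Group H] [Group K] {g : G} {h : H}

theorem left_eq_right : left g h g = right g h h := by
  have : ((g, h⁻¹) : G × H) ∈ Subgroup.normalClosure ({(g, h⁻¹)} : Set (G × H)) :=
    Subgroup.subset_normalClosure rfl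
  have h2 : ((g, 1) : G × H) = (g, h⁻¹) * (1, h) := by simp
  change QuotientGroup.mk' _ ((g, 1) : G × H) = QuotientGroup.mk' _ ((1, h) : G × H)
  rw [h2, map_mul, QuotientGroup.mk'_apply, (QuotientGroup.eq_one_iff _).2 this, one_mul]

theorem commute_left_right (x : G) (y : H) : Commute (left g h x) (right g h y) :=
  (MonoidHom.commute_inl_inr x y).map (QuotientGroup.mk' _)

/-- The universal property of the central product. -/
def lift (F : G →* K) (F' : H →* K) (hc : ∀ x y, Commute (F x) (F' y)) (hgh : F g = F' h) :
    CentralProduct g h →* K :=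
  QuotientGroup.lift _ (F.noncommCoprod F' hc) (by
    have : Subgroup.normalClosure ({(g, h⁻¹)} : Set (G × H)) ≤ (F.noncommCoprod F' hc).ker := by
      refine Subgroup.normalClosure_le_normal ?_
      rintro _ rfl
      simp [MonoidHom.mem_ker, hgh]
    exact this)

variable (F : G →* K) (F' : H →* K) (hc : ∀ x y, Commute (F x) (F' y)) (hgh : F g = F' h)

@[simp]
theorem lift_left (x : G) : lift F F' hc hgh (left g h x) = F x := by
  change F x * F' 1 = F x
  simp

@[simp]
theorem lift_right (y : H) : lift F F' hc hgh (right g h y) = F' y := by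
  change F 1 * F' y = F' y
  simp

theorem eq_left_mul_right (z : CentralProduct g h) : ∃ x y, z = left g h x * right g h y := by
  obtain ⟨z, rfl⟩ := QuotientGroup.mk'_surjective _ z
  refine ⟨z.1, z.2, ?_⟩
  change QuotientGroup.mk' _ z = QuotientGroup.mk' _ (z.1, 1) * QuotientGroup.mk' _ (1, z.2)
  rw [← map_mul]; simp

theorem hom_ext {F F' : CentralProduct g h →* K} (hl : ∀ x, F (left g h x) = F' (left g h x))
    (hr : ∀ y, F (right g h y) = F' (right g h y)) : F = F' := by
  ext z
  obtain ⟨x, y, hz⟩ := eq_left_mul_right (g := g) (h := h) (QuotientGroup.mk' _ z)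
  change F (QuotientGroup.mk' _ z) = F' (QuotientGroup.mk' _ z)
  rw [hz, map_mul, map_mul, hl, hr]

end CentralProduct

/-! ### Normal form and universal property of `Qf(p)`. -/

namespace Qf

variable {p : ℕ}

theorem b_pow (k : ℕ) : b p ^ k = ⟨k, 0, 0⟩ := by
  induction k with
  | zero => ext <;> simp
  | succ k ih => rw [pow_succ, ih]; ext <;> simp [b]

theorem c_pow (k : ℕ) : c p ^ k = ⟨0, k, 0⟩ := by
  induction k with
  | zero => ext <;> simp
  | succ k ih => rw [pow_succ, ih]; ext <;> simp [c]

theorem a_pow (k : ℕ) : a p ^ k = ⟨0, 0, k⟩ := by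
  induction k with
  | zero => ext <;> simp
  | succ k ih => rw [pow_succ, ih]; ext <;> simp [a]

theorem b_zpow (k : ℤ) : b p ^ k = ⟨k, 0, 0⟩ := by
  obtain ⟨k, rfl | rfl⟩ := k.eq_nat_or_neg
  · rw [zpow_natCast, b_pow]; simp
  · rw [zpow_neg, zpow_natCast, b_pow]; ext <;> simp

theorem c_zpow (k : ℤ) : c p ^ k = ⟨0, k, 0⟩ := by
  obtain ⟨k, rfl | rfl⟩ := k.eq_nat_or_neg
  · rw [zpow_natCast, c_pow]; simp
  · rw [zpow_neg, zpow_natCast, c_pow]; ext <;> simp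

/-- The normal form in `Qf p`. -/
theorem eq_normalForm [NeZero p] (g : Qf p) :
    g = c p ^ g.y.val * b p ^ g.x.val * a p ^ g.z.val := by
  rw [a_pow, b_pow, c_pow]; ext <;> simp

variable {K : Type} [Group K]

theorem hom_ext [NeZero p] {F F' : Qf p →* K} (ha : F (a p) = F' (a p)) (hb : F (b p) = F' (b p))
    (hc : F (c p) = F' (c p)) : F = F' := by
  ext g
  rw [eq_normalForm g]
  simp only [map_mul, map_pow, ha, hb, hc]

/-- Each of the `i * j` exchanges of a `v` with a `w` releases one factor `u`, which commutes with
both. -/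
theorem pow_mul_pow_of_heisenberg {u v w : K} (hu : Commute u v) (hw : Commute u w)
    (h : v * w = w * v * u) (i j : ℕ) : v ^ i * w ^ j = w ^ j * v ^ i * u ^ (i * j) := by
  have h1 : ∀ i : ℕ, v ^ i * w = w * v ^ i * u ^ i := by
    intro i
    induction i with
    | zero => simp
    | succ i ih =>
      calc v ^ (i + 1) * w = v ^ i * (v * w) := by rw [pow_succ, mul_assoc]
        _ = v ^ i * w * (v * u) := by rw [h]; group
        _ = w * v ^ i * (u ^ i * v) * u := by rw [ih]; group
        _ = w * v ^ i * (v * u ^ i) * u := by rw [(hu.pow_left i).eq]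
        _ = w * v ^ (i + 1) * u ^ (i + 1) := by rw [pow_succ v, pow_succ u]; group
  induction j with
  | zero => simp
  | succ j ih =>
    calc v ^ i * w ^ (j + 1) = v ^ i * w ^ j * w := by rw [pow_succ, mul_assoc]
      _ = w ^ j * v ^ i * (u ^ (i * j) * w) := by rw [ih]; group
      _ = w ^ j * (v ^ i * w) * u ^ (i * j) := by rw [(hw.pow_left _).eq]; group
      _ = w ^ (j + 1) * v ^ i * (u ^ i * u ^ (i * j)) := by rw [h1, pow_succ w]; group
      _ = w ^ (j + 1) * v ^ i * u ^ (i * (j + 1)) := by rw [← pow_add]; ring_nf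

/-- The universal property of `Qf p`. -/
def lift [NeZero p] (u v w : K) (hup : u ^ p = 1) (hvp : v ^ p = 1) (hwp : w ^ p = 1)
    (hu : Commute u v) (hw : Commute u w) (h : v * w = w * v * u) : Qf p →* K :=
  MonoidHom.mk' (fun g => cycLift p w hwp (.ofAdd g.y) * cycLift p v hvp (.ofAdd g.x) *
      cycLift p u hup (.ofAdd g.z)) (by
    have cl : ∀ (g : K) (hg : g ^ p = 1) (x : ZMod p),
        cycLift p g hg (.ofAdd x) = g ^ x.val := by
      intro g hg x
      have := cycLift_ofAdd_intCast g hg (x.val : ℤ)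
      rwa [zpow_natCast, Int.cast_natCast, ZMod.natCast_zmod_val] at this
    intro g g'
    -- Moving `w` to the left of `v` produces exactly the bilinear term `g.x * g'.y` of the
    -- multiplication of `Qf p`; as `u ^ p = 1`, the exponent matters only modulo `p`.
    have key : cycLift p v hvp (.ofAdd g.x) * cycLift p w hwp (.ofAdd g'.y) =
        cycLift p w hwp (.ofAdd g'.y) * cycLift p v hvp (.ofAdd g.x) *
          cycLift p u hup (.ofAdd (g.x * g'.y)) := by
      have : cycLift p u hup (.ofAdd (g.x * g'.y)) = u ^ (g.x.val * g'.y.val) := by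
        have := cycLift_ofAdd_intCast u hup ((g.x.val * g'.y.val : ℕ) : ℤ)
        rw [zpow_natCast] at this
        rw [← this]; simp
      rw [this, cl, cl]
      exact pow_mul_pow_of_heisenberg hu hw h _ _
    have cv : ∀ x y, Commute (cycLift p u hup x) (cycLift p v hvp y) := fun x y =>
      (commute_cycLift hvp (commute_cycLift hup hu.symm x).symm y)
    have cw : ∀ x y, Commute (cycLift p u hup x) (cycLift p w hwp y) := fun x y =>
      (commute_cycLift hwp (commute_cycLift hup hw.symm x).symm y)
    simp only [mul_x, mul_y, mul_z, ofAdd_add, map_mul]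
    have e1 := (cw (.ofAdd g.z) (.ofAdd g'.y)).eq
    have e2 := (cv (.ofAdd g.z) (.ofAdd g'.x)).eq
    have e3 := (cv (.ofAdd (g.x * g'.y)) (.ofAdd g'.x)).eq
    have e4 : cycLift p u hup (.ofAdd g.z) * cycLift p u hup (.ofAdd g'.z) *
        cycLift p u hup (.ofAdd (g.x * g'.y)) = cycLift p u hup (.ofAdd (g.x * g'.y)) *
        cycLift p u hup (.ofAdd g.z) * cycLift p u hup (.ofAdd g'.z) := by
      simp only [← map_mul, ← ofAdd_add]
      congr 2
      ring
    rw [e4]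
    generalize cycLift p u hup (.ofAdd (g.x * g'.y)) = u₂ at *
    generalize cycLift p u hup (.ofAdd g.z) = u₀ at *
    generalize cycLift p u hup (.ofAdd g'.z) = u₁ at *
    generalize cycLift p v hvp (.ofAdd g.x) = v₀ at *
    generalize cycLift p v hvp (.ofAdd g'.x) = v₁ at *
    generalize cycLift p w hwp (.ofAdd g.y) = w₀ at *
    generalize cycLift p w hwp (.ofAdd g'.y) = w₁ at *
    calc w₀ * w₁ * (v₀ * v₁) * (u₂ * u₀ * u₁) = w₀ * (w₁ * v₀) * (v₁ * u₂) * u₀ * u₁ := by group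
      _ = w₀ * (w₁ * v₀ * u₂) * (v₁ * u₀) * u₁ := by rw [← e3]; group
      _ = w₀ * v₀ * (w₁ * u₀) * v₁ * u₁ := by rw [← key, ← e2]; group
      _ = w₀ * v₀ * u₀ * (w₁ * v₁ * u₁) := by rw [← e1]; group)

variable [NeZero p] (u v w : K) (hup : u ^ p = 1) (hvp : v ^ p = 1) (hwp : w ^ p = 1)
  (hu : Commute u v) (hw : Commute u w) (h : v * w = w * v * u)

theorem lift_apply (g : Qf p) : lift u v w hup hvp hwp hu hw h g =
    cycLift p w hwp (.ofAdd g.y) * cycLift p v hvp (.ofAdd g.x) * cycLift p u hup (.ofAdd g.z) :=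
  rfl

theorem lift_a : lift u v w hup hvp hwp hu hw h (a p) = u := by
  have := cycLift_gen u hup
  rw [Cyc.gen] at this
  simp [lift_apply, a, this]

theorem lift_b : lift u v w hup hvp hwp hu hw h (b p) = v := by
  have := cycLift_gen v hvp
  rw [Cyc.gen] at this
  simp [lift_apply, b, this]

theorem lift_c : lift u v w hup hvp hwp hu hw h (c p) = w := by
  have := cycLift_gen w hwp
  rw [Cyc.gen] at this
  simp [lift_apply, c, this]

end Qf

/-! ### The presented group and the relations as equations. -/

section Relations

variable {G K : Type} [Group G] [Group K]

theorem map_comm (F : G →* K) (g h : G) : F (comm g h) = comm (F g) (F h) := by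
  simp [comm]

theorem map_conjBy (F : G →* K) (g h : G) : F (conjBy g h) = conjBy (F g) (F h) := by
  simp [conjBy]

theorem comm_eq_one_iff (g h : G) : comm g h = 1 ↔ Commute g h := by
  rw [comm, mul_assoc, ← mul_inv_rev, inv_mul_eq_one, commute_iff_eq, eq_comm]

/-- The elements `v a, …, v f` of a group satisfy the relations of the presentation of
`Aut(C_y × C_p)`. -/
structure AutRelsHold (p n : ℕ) (s t : ℤ) (v : AutGen → K) : Prop where
  a_pow : v .a ^ p = 1
  b_pow : v .b ^ p = 1
  c_pow : v .c ^ p = 1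
  ab : Commute (v .a) (v .b)
  ac : Commute (v .a) (v .c)
  bc : v .b * v .c = v .c * v .b * v .a
  f_pow : v .f ^ p ^ (n - 1) = 1
  af : Commute (v .a) (v .f)
  bf : Commute (v .b) (v .f)
  cf : Commute (v .c) (v .f)
  a_eq : v .a = v .f ^ p ^ (n - 2)
  d_pow : v .d ^ (p - 1) = 1
  ad : Commute (v .a) (v .d)
  bd : (v .d)⁻¹ * v .b * v .d = v .b ^ s
  cd : (v .d)⁻¹ * v .c * v .d = v .c ^ t
  df : Commute (v .d) (v .f)
  e_pow : v .e ^ (p - 1) = 1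
  ae : Commute (v .a) (v .e)
  be : Commute (v .b) (v .e)
  ce : Commute (v .c) (v .e)
  de : Commute (v .d) (v .e)
  ef : Commute (v .e) (v .f)

variable {p n : ℕ} {s t : ℤ}

/-- The straightening form of the relator: `c` moves to the left of `b` at the cost of one `a`, as
`Qf.lift` requires. -/
theorem conj_rel_iff (a b c : G) :
    conjBy b c * a⁻¹ * b⁻¹ = 1 ↔ b * c = c * b * a := by
  rw [conjBy, mul_inv_eq_one, mul_inv_eq_iff_eq_mul, mul_assoc, inv_mul_eq_iff_eq_mul, mul_assoc]

theorem autRelsHold_iff (v : AutGen → K) :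
    (∀ r ∈ autRels p n s t, FreeGroup.lift v r = 1) ↔ AutRelsHold p n s t v := by
  simp only [autRels, Set.mem_insert_iff, Set.mem_singleton_iff, forall_eq_or_imp, forall_eq,
    map_mul, map_pow, map_zpow, map_inv, map_comm, map_conjBy, FreeGroup.lift_apply_of,
    comm_eq_one_iff, zpow_neg, mul_inv_eq_one (b := _ ^ (_ : ℤ)),
    mul_inv_eq_one (b := _ ^ (_ : ℕ))]
  constructor
  · rintro ⟨h1, h2, h3, h4, h5, h6, h7, h8, h9, h10, h11, h12, h13, h14, h15, h16, h17, h18, h19,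
      h20, h21, h22⟩
    exact ⟨h1, h2, h3, h4, h5, (conj_rel_iff _ _ _).1 h6, h7, h8, h9, h10, h11, h12, h13, h14,
      h15, h16, h17, h18, h19, h20, h21, h22⟩
  · rintro ⟨h1, h2, h3, h4, h5, h6, h7, h8, h9, h10, h11, h12, h13, h14, h15, h16, h17, h18, h19,
      h20, h21, h22⟩
    exact ⟨h1, h2, h3, h4, h5, (conj_rel_iff _ _ _).2 h6, h7, h8, h9, h10, h11, h12, h13, h14,
      h15, h16, h17, h18, h19, h20, h21, h22⟩

/-- The group presented by the relations of `Aut(C_y × C_p)`. -/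
abbrev AutPres (p n : ℕ) (s t : ℤ) : Type := PresentedGroup (autRels p n s t)

/-- The generators of `AutPres`. -/
def gen (p n : ℕ) (s t : ℤ) (g : AutGen) : AutPres p n s t := PresentedGroup.of g

theorem autRelsHold_of_hom (F : FreeGroup AutGen →* K) (h : ∀ r ∈ autRels p n s t, F r = 1) :
    AutRelsHold p n s t (fun g => F (FreeGroup.of g)) := by
  rw [← autRelsHold_iff]
  intro r hr
  rw [← h r hr]
  congr 1
  ext g
  simp

theorem gen_holds (p n : ℕ) (s t : ℤ) : AutRelsHold p n s t (gen p n s t) :=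
  autRelsHold_of_hom (PresentedGroup.mk (autRels p n s t))
    fun _ hr => PresentedGroup.one_of_mem hr

/-- The homomorphism from `AutPres` given by elements that satisfy the relations. -/
def autLift {v : AutGen → K} (h : AutRelsHold p n s t v) : AutPres p n s t →* K :=
  PresentedGroup.toGroup ((autRelsHold_iff v).2 h)

@[simp]
theorem autLift_gen {v : AutGen → K} (h : AutRelsHold p n s t v) (g : AutGen) :
    autLift h (gen p n s t g) = v g :=
  PresentedGroup.toGroup.of _

theorem commute_of_commute_gen {u : AutPres p n s t}
    (h : ∀ g, Commute u (gen p n s t g)) (x : AutPres p n s t) : Commute u x := by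
  have := PresentedGroup.generated_by (autRels p n s t) (Subgroup.centralizer {u})
    (fun g => by
      rw [Subgroup.mem_centralizer_iff]
      rintro _ rfl
      exact h g) x
  exact Subgroup.mem_centralizer_iff.1 this u rfl

/-- Centrality of `e` lets the last direct factor `C_{p-1}` map into the presented group alongside
the rest. -/
theorem commute_e (x : AutPres p n s t) : Commute (gen p n s t .e) x := by
  obtain h := gen_holds p n s t
  refine commute_of_commute_gen ?_ x
  rintro (_ | _ | _ | _ | _ | _)
  exacts [h.ae.symm, h.be.symm, h.ce.symm, h.de.symm, .refl _, h.ef]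

/-- Centrality of `f`, including its commuting with `d`, allows `C_z` to be amalgamated after the
extension by `d` in the second decomposition. -/
theorem commute_f (x : AutPres p n s t) : Commute (gen p n s t .f) x := by
  obtain h := gen_holds p n s t
  refine commute_of_commute_gen ?_ x
  rintro (_ | _ | _ | _ | _ | _)
  exacts [h.af.symm, h.bf.symm, h.cf.symm, h.df.symm, h.ef.symm, .refl _]

end Relations

/-! ### The presented group as each of the two explicit products. -/

section Targets

variable {p n : ℕ} {s t : ℤ} [NeZero p] {K : Type} [Group K] {v : AutGen → K}

theorem qf_commute_of_gens {F : Qf p →* K} {u : K} (ha : Commute u (F (Qf.a p)))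
    (hb : Commute u (F (Qf.b p))) (hc : Commute u (F (Qf.c p))) (x : Qf p) : Commute u (F x) := by
  rw [Qf.eq_normalForm x]
  simp only [map_mul, map_pow]
  exact ((hc.pow_right _).mul_right (hb.pow_right _)).mul_right (ha.pow_right _)

namespace AutRelsHold

/-- The subgroup generated by `a`, `b`, `c` is an image of `Qf p`. -/
def qfHom (h : AutRelsHold p n s t v) : Qf p →* K :=
  Qf.lift (v .a) (v .b) (v .c) h.a_pow h.b_pow h.c_pow h.ab h.ac h.bc

variable (h : AutRelsHold p n s t v)

@[simp] theorem qfHom_a : h.qfHom (Qf.a p) = v .a := Qf.lift_a ..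
@[simp] theorem qfHom_b : h.qfHom (Qf.b p) = v .b := Qf.lift_b ..
@[simp] theorem qfHom_c : h.qfHom (Qf.c p) = v .c := Qf.lift_c ..

/-- The subgroup generated by `a`, `b`, `c`, `f` is an image of `Qf(p) Y C_z`. -/
def qfycHom : QfYC p n →* K :=
  CentralProduct.lift h.qfHom (cycLift _ (v .f) h.f_pow)
    (fun x y => commute_cycLift _ (qf_commute_of_gens (by simpa using h.af.symm)
      (by simpa using h.bf.symm) (by simpa using h.cf.symm) x).symm y)
    (by simpa using h.a_eq)

@[simp] theorem qfycHom_a : h.qfycHom (QfYC.a p n) = v .a := by simp [qfycHom, QfYC.a]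
@[simp] theorem qfycHom_b : h.qfycHom (QfYC.b p n) = v .b := by simp [qfycHom, QfYC.b]
@[simp] theorem qfycHom_c : h.qfycHom (QfYC.c p n) = v .c := by simp [qfycHom, QfYC.c]
@[simp] theorem qfycHom_f : h.qfycHom (QfYC.f p n) = v .f := by simp [qfycHom, QfYC.f]

end AutRelsHold

theorem qfyc_hom_ext {F F' : QfYC p n →* K} (ha : F (QfYC.a p n) = F' (QfYC.a p n))
    (hb : F (QfYC.b p n) = F' (QfYC.b p n)) (hc : F (QfYC.c p n) = F' (QfYC.c p n))
    (hf : F (QfYC.f p n) = F' (QfYC.f p n)) : F = F' := by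
  refine CentralProduct.hom_ext (fun x => ?_) (fun y => ?_)
  · exact DFunLike.congr_fun (Qf.hom_ext (F := F.comp (CentralProduct.left _ _))
      (F' := F'.comp (CentralProduct.left _ _)) ha hb hc) x
  · exact DFunLike.congr_fun (cyc_hom_ext (F := F.comp (CentralProduct.right _ _))
      (F' := F'.comp (CentralProduct.right _ _)) hf) y

/-- The relations between the generators of `Qf(p) Y C_z`. -/
theorem qfyc_rels (p n : ℕ) :
    QfYC.a p n ^ p = 1 ∧ QfYC.b p n ^ p = 1 ∧ QfYC.c p n ^ p = 1 ∧
    Commute (QfYC.a p n) (QfYC.b p n) ∧ Commute (QfYC.a p n) (QfYC.c p n) ∧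
    QfYC.b p n * QfYC.c p n = QfYC.c p n * QfYC.b p n * QfYC.a p n ∧
    QfYC.f p n ^ p ^ (n - 1) = 1 ∧ Commute (QfYC.a p n) (QfYC.f p n) ∧
    Commute (QfYC.b p n) (QfYC.f p n) ∧ Commute (QfYC.c p n) (QfYC.f p n) ∧
    QfYC.a p n = QfYC.f p n ^ p ^ (n - 2) := by
  refine ⟨?_, ?_, ?_, ?_, ?_, ?_, ?_, CentralProduct.commute_left_right _ _,
    CentralProduct.commute_left_right _ _, CentralProduct.commute_left_right _ _,
    CentralProduct.left_eq_right.trans (map_pow _ _ _)⟩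
  · rw [QfYC.a, ← map_pow, Qf.a_pow, ← map_one (CentralProduct.left _ _)]
    congr 1; ext <;> simp
  · rw [QfYC.b, ← map_pow, Qf.b_pow, ← map_one (CentralProduct.left _ _)]
    congr 1; ext <;> simp
  · rw [QfYC.c, ← map_pow, Qf.c_pow, ← map_one (CentralProduct.left _ _)]
    congr 1; ext <;> simp
  · exact Commute.map (by ext <;> simp [Qf.a, Qf.b]) _
  · exact Commute.map (by ext <;> simp [Qf.a, Qf.c]) _
  · rw [QfYC.a, QfYC.b, QfYC.c, ← map_mul, ← map_mul, ← map_mul]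
    congr 1; ext <;> simp [Qf.a, Qf.b, Qf.c]
  · rw [QfYC.f, ← map_pow, cyc_gen_pow, map_one]

omit [NeZero p] in
theorem gensOne_holds {φ : Cyc (p - 1) →* MulAut (QfYC p n)} (hφ : IsQfYCAction p n s t φ) :
    AutRelsHold p n s t (gensOne p n φ) := by
  obtain ⟨h1, h2, h3, h4, h5, h6, h7, h8, h9, h10, h11⟩ := qfyc_rels p n
  let J : QfYC p n →* (QfYC p n ⋊[φ] Cyc (p - 1)) × Cyc (p - 1) :=
    (MonoidHom.inl _ _).comp SemidirectProduct.inl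
  let D : Cyc (p - 1) →* (QfYC p n ⋊[φ] Cyc (p - 1)) × Cyc (p - 1) :=
    (MonoidHom.inl _ _).comp SemidirectProduct.inr
  let E : Cyc (p - 1) →* (QfYC p n ⋊[φ] Cyc (p - 1)) × Cyc (p - 1) := MonoidHom.inr _ _
  -- Conjugation `d⁻¹ * u * d` in the semidirect product is the inverse of the action of `d`, which
  -- is why `IsQfYCAction` is phrased with inverses.
  have conj : ∀ u, (D (Cyc.gen _))⁻¹ * J u * D (Cyc.gen _) = J ((φ (Cyc.gen _))⁻¹ u) := by
    intro u
    simp only [J, D, MonoidHom.comp_apply, SemidirectProduct.inl_aut_inv, map_mul, map_inv]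
  have hd : ∀ u, (φ (Cyc.gen _))⁻¹ u = u → Commute (J u) (D (Cyc.gen _)) := by
    intro u hu
    have := conj u
    rw [hu, mul_assoc, inv_mul_eq_iff_eq_mul] at this
    exact this
  have he : ∀ u, Commute (MonoidHom.inl _ _ u) (E (Cyc.gen _)) := fun u =>
    MonoidHom.commute_inl_inr _ _
  exact
    { a_pow := (map_pow J _ _).symm.trans (by rw [h1, map_one])
      b_pow := (map_pow J _ _).symm.trans (by rw [h2, map_one])
      c_pow := (map_pow J _ _).symm.trans (by rw [h3, map_one])
      ab := h4.map J
      ac := h5.map J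
      bc := (map_mul J _ _).symm.trans (by rw [h6, map_mul, map_mul]; rfl)
      f_pow := (map_pow J _ _).symm.trans (by rw [h7, map_one])
      af := h8.map J
      bf := h9.map J
      cf := h10.map J
      a_eq := Eq.trans (congrArg J h11) (map_pow J _ _)
      d_pow := (map_pow D _ _).symm.trans (by rw [cyc_gen_pow, map_one])
      ad := hd _ hφ.map_a
      bd := (conj _).trans (by rw [hφ.map_b, map_zpow]; rfl)
      cd := (conj _).trans (by rw [hφ.map_c, map_zpow]; rfl)
      df := (hd _ hφ.map_f).symm
      e_pow := (map_pow E _ _).symm.trans (by rw [cyc_gen_pow, map_one])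
      ae := he _
      be := he _
      ce := he _
      de := he _
      ef := (he _).symm }

variable {φ : Cyc (p - 1) →* MulAut (QfYC p n)}

/-- The subgroup generated by `a`, `b`, `c`, `d`, `f` is an image of `(Qf(p) Y C_z) ⋊ C_{p-1}`. -/
def AutRelsHold.semidirectHom (h : AutRelsHold p n s t v) (hφ : IsQfYCAction p n s t φ) :
    QfYC p n ⋊[φ] Cyc (p - 1) →* K :=
  SemidirectProduct.lift h.qfycHom (cycLift _ (v .d) h.d_pow)
    (semidirect_compat _ _ (closure_cyc_gen _) (by
      rintro _ rfl x
      have : h.qfycHom.comp (φ (Cyc.gen _))⁻¹.toMonoidHom =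
          (MulAut.conj (v .d)⁻¹).toMonoidHom.comp h.qfycHom := by
        refine qfyc_hom_ext ?_ ?_ ?_ ?_
        · exact (congrArg h.qfycHom hφ.map_a).trans (by simp [mul_assoc, h.ad.eq])
        · exact (congrArg h.qfycHom hφ.map_b).trans (by simp [h.bd])
        · exact (congrArg h.qfycHom hφ.map_c).trans (by simp [h.cd])
        · exact (congrArg h.qfycHom hφ.map_f).trans (by simp [mul_assoc, h.df.symm.eq])
      refine (DFunLike.congr_fun this x).trans ?_
      simp))

theorem AutRelsHold.semidirectHom_inl (h : AutRelsHold p n s t v) (hφ : IsQfYCAction p n s t φ)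
    (x : QfYC p n) : h.semidirectHom hφ (SemidirectProduct.inl x) = h.qfycHom x :=
  SemidirectProduct.lift_inl ..

theorem AutRelsHold.semidirectHom_inr (h : AutRelsHold p n s t v) (hφ : IsQfYCAction p n s t φ)
    (x : Cyc (p - 1)) :
    h.semidirectHom hφ (SemidirectProduct.inr x) = cycLift _ (v .d) h.d_pow x :=
  SemidirectProduct.lift_inr ..

/-- A homomorphism out of `G × C` is determined by its restrictions to the factors. -/
theorem prod_hom_ext {G H M : Type} [Group G] [Group H] [Group M] {F F' : G × H →* M}
    (hl : F.comp (MonoidHom.inl G H) = F'.comp (MonoidHom.inl G H))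
    (hr : F.comp (MonoidHom.inr G H) = F'.comp (MonoidHom.inr G H)) : F = F' := by
  ext ⟨x, y⟩
  have : (x, y) = MonoidHom.inl G H x * MonoidHom.inr G H y := by simp
  rw [this, map_mul, map_mul]
  exact congrArg₂ _ (DFunLike.congr_fun hl x) (DFunLike.congr_fun hr y)

/-- The presented group is `((Qf(p) Y C_z) ⋊ C_{p-1}) × C_{p-1}`. -/
theorem exists_equiv_gensOne (hφ : IsQfYCAction p n s t φ) :
    ∃ Θ : AutPres p n s t ≃* (QfYC p n ⋊[φ] Cyc (p - 1)) × Cyc (p - 1),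
      ∀ g, Θ (gen p n s t g) = gensOne p n φ g := by
  have h := gen_holds p n s t
  let F := autLift (gensOne_holds hφ)
  let F' : (QfYC p n ⋊[φ] Cyc (p - 1)) × Cyc (p - 1) →* AutPres p n s t :=
    (h.semidirectHom hφ).noncommCoprod (cycLift _ (gen p n s t .e) h.e_pow)
      (fun x y => commute_cycLift _ (commute_e _).symm y)
  have hinl : ∀ x, F' (x, 1) = h.semidirectHom hφ x := fun x => by simp [F']
  have hinr : ∀ y, F' (1, y) = cycLift _ (gen p n s t .e) h.e_pow y := fun y => by simp [F']
  have hF' : ∀ g, F' (gensOne p n φ g) = gen p n s t g := by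
    rintro (_ | _ | _ | _ | _ | _) <;>
    simp [gensOne, hinl, hinr, h.semidirectHom_inl, h.semidirectHom_inr]
  -- The two homomorphisms match the generators, so both composites are the identity; no group
  -- orders have to be computed.
  have hFF' : ∀ g, F (F' (gensOne p n φ g)) = gensOne p n φ g := fun g => by
    rw [hF', autLift_gen]
  refine ⟨MonoidHom.toMulEquiv F F' ?_ ?_, fun g => autLift_gen (gensOne_holds hφ) g⟩
  · exact PresentedGroup.ext fun g => (congrArg F' (autLift_gen _ g)).trans (hF' g)
  · refine prod_hom_ext (SemidirectProduct.hom_ext ?_ ?_) ?_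
    · exact qfyc_hom_ext (hFF' .a) (hFF' .b) (hFF' .c) (hFF' .f)
    · exact cyc_hom_ext (hFF' .d)
    · exact cyc_hom_ext (hFF' .e)

variable {ψ : Cyc (p - 1) →* MulAut (Qf p)}

omit [NeZero p] in
theorem gensTwo_holds (hψ : IsQfAction p s t ψ) : AutRelsHold p n s t (gensTwo p n ψ) := by
  let J : Qf p ⋊[ψ] Cyc (p - 1) →* QfCYC p n ψ × Cyc (p - 1) :=
    (MonoidHom.inl _ _).comp (CentralProduct.left _ _)
  let I : Qf p →* QfCYC p n ψ × Cyc (p - 1) := J.comp SemidirectProduct.inl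
  let D : Cyc (p - 1) →* QfCYC p n ψ × Cyc (p - 1) := J.comp SemidirectProduct.inr
  let E : Cyc (p - 1) →* QfCYC p n ψ × Cyc (p - 1) := MonoidHom.inr _ _
  let C : Cyc (p ^ (n - 1)) →* QfCYC p n ψ × Cyc (p - 1) :=
    (MonoidHom.inl _ _).comp (CentralProduct.right _ _)
  have conj : ∀ u, (D (Cyc.gen _))⁻¹ * I u * D (Cyc.gen _) = I ((ψ (Cyc.gen _))⁻¹ u) := by
    intro u
    simp only [I, D, MonoidHom.comp_apply, SemidirectProduct.inl_aut_inv, map_mul, map_inv]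
  have hd : ∀ u, (ψ (Cyc.gen _))⁻¹ u = u → Commute (I u) (D (Cyc.gen _)) := by
    intro u hu
    have := conj u
    rw [hu, mul_assoc, inv_mul_eq_iff_eq_mul] at this
    exact this
  have he : ∀ u, Commute (MonoidHom.inl _ _ u) (E (Cyc.gen _)) := fun u =>
    MonoidHom.commute_inl_inr _ _
  have hf : ∀ u, Commute (J u) (C (Cyc.gen _)) := fun u =>
    (CentralProduct.commute_left_right u (Cyc.gen _)).map (MonoidHom.inl _ _)
  exact
    { a_pow := (map_pow I _ _).symm.trans (by
        rw [Qf.a_pow, ← map_one I]; congr 1; ext <;> simp)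
      b_pow := (map_pow I _ _).symm.trans (by
        rw [Qf.b_pow, ← map_one I]; congr 1; ext <;> simp)
      c_pow := (map_pow I _ _).symm.trans (by
        rw [Qf.c_pow, ← map_one I]; congr 1; ext <;> simp)
      ab := Commute.map (x := Qf.a p) (y := Qf.b p) (by ext <;> simp [Qf.a, Qf.b]) I
      ac := Commute.map (x := Qf.a p) (y := Qf.c p) (by ext <;> simp [Qf.a, Qf.c]) I
      bc := by
        have : Qf.b p * Qf.c p = Qf.c p * Qf.b p * Qf.a p := by
          ext <;> simp [Qf.a, Qf.b, Qf.c]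
        have := congrArg I this
        rw [map_mul, map_mul, map_mul] at this
        exact this
      f_pow := (map_pow C _ _).symm.trans (by rw [cyc_gen_pow, map_one])
      af := hf _
      bf := hf _
      cf := hf _
      a_eq := Eq.trans (congrArg (MonoidHom.inl _ _) CentralProduct.left_eq_right)
        (map_pow C _ _)
      d_pow := (map_pow D _ _).symm.trans (by rw [cyc_gen_pow, map_one])
      ad := hd _ hψ.map_a
      bd := (conj _).trans (by rw [hψ.map_b, map_zpow]; rfl)
      cd := (conj _).trans (by rw [hψ.map_c, map_zpow]; rfl)
      df := hf _
      e_pow := (map_pow E _ _).symm.trans (by rw [cyc_gen_pow, map_one])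
      ae := he _
      be := he _
      ce := he _
      de := he _
      ef := (he _).symm }

/-- The subgroup generated by `a`, `b`, `c`, `d` is an image of `Qf(p) ⋊ C_{p-1}`. -/
def AutRelsHold.qfSemidirectHom (h : AutRelsHold p n s t v) (hψ : IsQfAction p s t ψ) :
    Qf p ⋊[ψ] Cyc (p - 1) →* K :=
  SemidirectProduct.lift h.qfHom (cycLift _ (v .d) h.d_pow)
    (semidirect_compat _ _ (closure_cyc_gen _) (by
      rintro _ rfl x
      have : h.qfHom.comp (ψ (Cyc.gen _))⁻¹.toMonoidHom =
          (MulAut.conj (v .d)⁻¹).toMonoidHom.comp h.qfHom := by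
        refine Qf.hom_ext ?_ ?_ ?_
        · exact (congrArg h.qfHom hψ.map_a).trans (by simp [mul_assoc, h.ad.eq])
        · exact (congrArg h.qfHom hψ.map_b).trans (by simp [h.bd])
        · exact (congrArg h.qfHom hψ.map_c).trans (by simp [h.cd])
      refine (DFunLike.congr_fun this x).trans ?_
      simp))

theorem AutRelsHold.qfSemidirectHom_inl (h : AutRelsHold p n s t v) (hψ : IsQfAction p s t ψ)
    (x : Qf p) : h.qfSemidirectHom hψ (SemidirectProduct.inl x) = h.qfHom x :=
  SemidirectProduct.lift_inl ..

theorem AutRelsHold.qfSemidirectHom_inr (h : AutRelsHold p n s t v) (hψ : IsQfAction p s t ψ)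
    (x : Cyc (p - 1)) :
    h.qfSemidirectHom hψ (SemidirectProduct.inr x) = cycLift _ (v .d) h.d_pow x :=
  SemidirectProduct.lift_inr ..

/-- The presented group is `((Qf(p) ⋊ C_{p-1}) Y C_z) × C_{p-1}`. -/
theorem exists_equiv_gensTwo (hψ : IsQfAction p s t ψ) :
    ∃ Θ : AutPres p n s t ≃* QfCYC p n ψ × Cyc (p - 1),
      ∀ g, Θ (gen p n s t g) = gensTwo p n ψ g := by
  have h := gen_holds p n s t
  let F := autLift (gensTwo_holds (n := n) hψ)
  let F₁ : QfCYC p n ψ →* AutPres p n s t :=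
    CentralProduct.lift (h.qfSemidirectHom hψ) (cycLift _ (gen p n s t .f) h.f_pow)
      (fun x y => commute_cycLift _ (commute_f _).symm y)
      (by simpa [h.qfSemidirectHom_inl] using h.a_eq)
  let F' : QfCYC p n ψ × Cyc (p - 1) →* AutPres p n s t :=
    F₁.noncommCoprod (cycLift _ (gen p n s t .e) h.e_pow)
      (fun x y => commute_cycLift _ (commute_e _).symm y)
  have hinl : ∀ x, F' (x, 1) = F₁ x := fun x => by simp [F']
  have hinr : ∀ y, F' (1, y) = cycLift _ (gen p n s t .e) h.e_pow y := fun y => by simp [F']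
  have hF' : ∀ g, F' (gensTwo p n ψ g) = gen p n s t g := by
    rintro (_ | _ | _ | _ | _ | _) <;>
    simp [gensTwo, hinl, hinr, F₁, h.qfSemidirectHom_inl, h.qfSemidirectHom_inr]
  have hFF' : ∀ g, F (F' (gensTwo p n ψ g)) = gensTwo p n ψ g := fun g => by
    rw [hF', autLift_gen]
  refine ⟨MonoidHom.toMulEquiv F F' ?_ ?_, fun g => autLift_gen (gensTwo_holds hψ) g⟩
  · exact PresentedGroup.ext fun g => (congrArg F' (autLift_gen _ g)).trans (hF' g)
  · refine prod_hom_ext (CentralProduct.hom_ext (fun x => ?_) (fun y => ?_)) ?_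
    · have : ((F.comp F').comp ((MonoidHom.inl _ _).comp (CentralProduct.left _ _))) =
          (MonoidHom.id (QfCYC p n ψ × Cyc (p - 1))).comp
            ((MonoidHom.inl _ _).comp (CentralProduct.left _ _)) := by
        refine SemidirectProduct.hom_ext ?_ ?_
        · exact Qf.hom_ext (hFF' .a) (hFF' .b) (hFF' .c)
        · exact cyc_hom_ext (hFF' .d)
      exact DFunLike.congr_fun this x
    · have : ((F.comp F').comp ((MonoidHom.inl _ _).comp (CentralProduct.right _ _))) =
          (MonoidHom.id (QfCYC p n ψ × Cyc (p - 1))).comp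
            ((MonoidHom.inl _ _).comp (CentralProduct.right _ _)) := cyc_hom_ext (hFF' .f)
      exact DFunLike.congr_fun this y
    · exact cyc_hom_ext (hFF' .e)

end Targets

/-! ### Existence of the actions of `C_{p-1}`. -/

section Actions

variable {p : ℕ}

/-- The automorphism `b ↦ b ^ u`, `c ↦ c ^ u⁻¹`, `a ↦ a` of `Qf p`. -/
def Qf.diag (u : (ZMod p)ˣ) : Qf p →* Qf p where
  toFun g := ⟨u * g.x, (u⁻¹ : (ZMod p)ˣ) * g.y, g.z⟩
  map_one' := by ext <;> simp
  map_mul' g h := by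
    ext
    · simp [mul_add]
    · simp [mul_add]
    · simp only [mul_z]
      -- The cross term is preserved because the scalars on the two coordinates are inverse to each
      -- other; hence `a` is fixed.
      linear_combination (-(g.x * h.y)) * (u.mul_inv)

theorem Qf.diag_diag (u v : (ZMod p)ˣ) (g : Qf p) : diag u (diag v g) = diag (u * v) g := by
  ext <;> simp [diag, mul_comm, mul_left_comm]

theorem Qf.diag_one (g : Qf p) : diag (1 : (ZMod p)ˣ) g = g := by
  ext <;> simp [diag]

theorem Qf.diag_a (u : (ZMod p)ˣ) : diag u (a p) = a p := by
  ext <;> simp [diag, a]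

theorem Qf.diag_b (u : (ZMod p)ˣ) (s : ℤ) (hs : (s : ZMod p) = u) : diag u (b p) = b p ^ s := by
  rw [b_zpow]
  ext <;> simp [diag, b, hs]

theorem Qf.diag_c (u : (ZMod p)ˣ) (t : ℤ) (ht : (t : ZMod p) = (u⁻¹ : (ZMod p)ˣ)) :
    diag u (c p) = c p ^ t := by
  rw [c_zpow]
  ext <;> simp [diag, c, ht]

/-- An action of a group by automorphisms, from an action by endomorphisms. -/
def mulAutOfEnd {G N : Type} [Group G] [Group N] (δ : G → N →* N) (h1 : ∀ x, δ 1 x = x)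
    (hmul : ∀ g h x, δ g (δ h x) = δ (g * h) x) : G →* MulAut N where
  toFun g := MonoidHom.toMulEquiv (δ g) (δ g⁻¹)
    (by ext x; simp [hmul, h1]) (by ext x; simp [hmul, h1])
  map_one' := by ext x; exact h1 x
  map_mul' g h := by ext x; exact (hmul g h x).symm

@[simp]
theorem mulAutOfEnd_apply {G N : Type} [Group G] [Group N] (δ : G → N →* N) (h1 : ∀ x, δ 1 x = x)
    (hmul : ∀ g h x, δ g (δ h x) = δ (g * h) x) (g : G) (x : N) :
    mulAutOfEnd δ h1 hmul g x = δ g x := rfl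

/-- The automorphism of the central product induced by `Qf.diag u`. -/
def QfYC.diag (n : ℕ) (u : (ZMod p)ˣ) : QfYC p n →* QfYC p n :=
  CentralProduct.lift ((CentralProduct.left _ _).comp (Qf.diag u)) (CentralProduct.right _ _)
    (fun _ _ => CentralProduct.commute_left_right _ _)
    (by rw [MonoidHom.comp_apply, Qf.diag_a, CentralProduct.left_eq_right])

theorem QfYC.diag_left {n : ℕ} (u : (ZMod p)ˣ) (x : Qf p) :
    QfYC.diag n u (CentralProduct.left _ _ x) = CentralProduct.left _ _ (Qf.diag u x) :=
  CentralProduct.lift_left ..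

theorem QfYC.diag_right {n : ℕ} (u : (ZMod p)ˣ) (y : Cyc (p ^ (n - 1))) :
    QfYC.diag n u (CentralProduct.right _ _ y) = CentralProduct.right _ _ y :=
  CentralProduct.lift_right ..

theorem QfYC.diag_diag {n : ℕ} (u v : (ZMod p)ˣ) (x : QfYC p n) :
    diag n u (diag n v x) = diag n (u * v) x := by
  have : (diag n u).comp (diag n v) = diag n (u * v) :=
    CentralProduct.hom_ext
      (fun x => by simp only [MonoidHom.comp_apply, diag_left, Qf.diag_diag])
      (fun y => by simp only [MonoidHom.comp_apply, diag_right])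
  exact DFunLike.congr_fun this x

theorem QfYC.diag_one {n : ℕ} (x : QfYC p n) : diag n (1 : (ZMod p)ˣ) x = x := by
  have : diag n (1 : (ZMod p)ˣ) = MonoidHom.id _ :=
    CentralProduct.hom_ext
      (fun x => by simp only [diag_left, Qf.diag_one, MonoidHom.id_apply])
      (fun y => by simp only [diag_right, MonoidHom.id_apply])
  exact DFunLike.congr_fun this x

variable {s t : ℤ} {u : (ZMod p)ˣ}

theorem exists_isQfAction (hu : u ^ (p - 1) = 1) (hs : (s : ZMod p) = u)
    (ht : (t : ZMod p) = (u⁻¹ : (ZMod p)ˣ)) :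
    ∃ ψ : Cyc (p - 1) →* MulAut (Qf p), IsQfAction p s t ψ := by
  let D : (ZMod p)ˣ →* MulAut (Qf p) := mulAutOfEnd Qf.diag Qf.diag_one Qf.diag_diag
  -- The generator is sent to `u⁻¹` so that its inverse, which gives conjugation by `d`, is `Qf.diag
  -- u`.
  refine ⟨D.comp (cycLift _ u⁻¹ (by rw [inv_pow, hu, inv_one])), ?_⟩
  have key : ∀ x, ((D.comp (cycLift _ u⁻¹ (by rw [inv_pow, hu, inv_one])))
      (Cyc.gen (p - 1)))⁻¹ x = Qf.diag u x := fun x => by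
    rw [MonoidHom.comp_apply, cycLift_gen, ← map_inv, inv_inv]; rfl
  exact ⟨by rw [key, Qf.diag_a], by rw [key, Qf.diag_b u s hs], by rw [key, Qf.diag_c u t ht]⟩

theorem exists_isQfYCAction (n : ℕ) (hu : u ^ (p - 1) = 1) (hs : (s : ZMod p) = u)
    (ht : (t : ZMod p) = (u⁻¹ : (ZMod p)ˣ)) :
    ∃ φ : Cyc (p - 1) →* MulAut (QfYC p n), IsQfYCAction p n s t φ := by
  let D : (ZMod p)ˣ →* MulAut (QfYC p n) :=
    mulAutOfEnd (QfYC.diag n) QfYC.diag_one QfYC.diag_diag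
  refine ⟨D.comp (cycLift _ u⁻¹ (by rw [inv_pow, hu, inv_one])), ?_⟩
  have key : ∀ x, ((D.comp (cycLift _ u⁻¹ (by rw [inv_pow, hu, inv_one])))
      (Cyc.gen (p - 1)))⁻¹ x = QfYC.diag n u x := fun x => by
    rw [MonoidHom.comp_apply, cycLift_gen, ← map_inv, inv_inv]; rfl
  exact
    { map_a := by rw [key, QfYC.a, QfYC.diag_left, Qf.diag_a]
      map_b := by rw [key, QfYC.b, QfYC.diag_left, Qf.diag_b u s hs, map_zpow]
      map_c := by rw [key, QfYC.c, QfYC.diag_left, Qf.diag_c u t ht, map_zpow]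
      map_f := by rw [key, QfYC.f, QfYC.diag_right] }

end Actions

/-! ### Endomorphisms of `C_y × C_p` as matrices. -/

section Endomorphisms

variable {p n : ℕ} [hn : Fact (1 < n)]

/-- Reduction modulo `p`. -/
def red (p n : ℕ) [hn : Fact (1 < n)] : ZMod (p ^ n) →+* ZMod p :=
  ZMod.castHom (dvd_pow_self p (Nat.ne_of_gt (Nat.zero_lt_of_lt hn.out))) (ZMod p)

theorem prime_mul_pow_pred (p n : ℕ) [hn : Fact (1 < n)] : p * p ^ (n - 1) = p ^ n := by
  rw [← pow_succ', Nat.sub_add_cancel hn.out.le]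

/-- The embedding `k ↦ p ^ (n - 1) * k` of `ZMod p` in `ZMod (p ^ n)`. -/
def emb (p n : ℕ) [hn : Fact (1 < n)] : ZMod p →+ ZMod (p ^ n) :=
  ZMod.lift p ⟨zmultiplesHom (ZMod (p ^ n)) ((p ^ (n - 1) : ℕ) : ZMod (p ^ n)), by
    rw [zmultiplesHom_apply, natCast_zsmul, nsmul_eq_mul, ← Nat.cast_mul, prime_mul_pow_pred,
      ZMod.natCast_self]⟩

theorem emb_intCast (k : ℤ) :
    emb p n (k : ZMod p) = (k : ZMod (p ^ n)) * ((p ^ (n - 1) : ℕ) : ZMod (p ^ n)) := by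
  rw [emb, ZMod.lift_coe, zmultiplesHom_apply, zsmul_eq_mul]

theorem emb_one : emb p n 1 = ((p ^ (n - 1) : ℕ) : ZMod (p ^ n)) := by
  simpa using emb_intCast (p := p) (n := n) 1

theorem red_intCast (k : ℤ) : red p n (k : ZMod (p ^ n)) = (k : ZMod p) := map_intCast _ _

/-- Multiples of `p ^ (n - 1)` modulo `p ^ n` see a scalar only through its residue modulo `p`. -/
theorem mul_emb (u : ZMod (p ^ n)) (y : ZMod p) : u * emb p n y = emb p n (red p n u * y) := by
  obtain ⟨m, rfl⟩ := ZMod.intCast_surjective u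
  obtain ⟨k, rfl⟩ := ZMod.intCast_surjective y
  rw [red_intCast, ← Int.cast_mul, emb_intCast, emb_intCast, Int.cast_mul, mul_assoc]

/-- Here `1 < n` is essential: it makes `p` divide `p ^ (n - 1)`. -/
theorem red_emb (y : ZMod p) : red p n (emb p n y) = 0 := by
  obtain ⟨k, rfl⟩ := ZMod.intCast_surjective y
  have : n - 1 ≠ 0 := Nat.sub_ne_zero_of_lt hn.out
  rw [emb_intCast, map_mul, map_natCast, Nat.cast_pow, ZMod.natCast_self, zero_pow this, mul_zero]

theorem emb_injective [Fact p.Prime] : Function.Injective (emb p n) := by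
  rw [injective_iff_map_eq_zero]
  intro y hy
  obtain ⟨k, rfl⟩ := ZMod.intCast_surjective y
  rw [emb_intCast, ← Int.cast_natCast, ← Int.cast_mul, ZMod.intCast_zmod_eq_zero_iff_dvd,
    ← prime_mul_pow_pred, Nat.cast_mul] at hy
  rw [ZMod.intCast_zmod_eq_zero_iff_dvd]
  exact Int.dvd_of_mul_dvd_mul_right
    (Nat.cast_ne_zero.2 (pow_ne_zero _ (Fact.out : p.Prime).ne_zero)) hy

theorem exists_emb_eq [Fact p.Prime] {q : ZMod (p ^ n)} (hq : p • q = 0) : ∃ v, emb p n v = q := by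
  obtain ⟨m, rfl⟩ := ZMod.intCast_surjective q
  rw [nsmul_eq_mul, ← Int.cast_natCast, ← Int.cast_mul, ZMod.intCast_zmod_eq_zero_iff_dvd,
    ← prime_mul_pow_pred, Nat.cast_mul] at hq
  obtain ⟨k, rfl⟩ := Int.dvd_of_mul_dvd_mul_left
    (Nat.cast_ne_zero.2 (Fact.out : p.Prime).ne_zero) hq
  refine ⟨(k : ZMod p), ?_⟩
  rw [emb_intCast, Int.cast_mul, mul_comm, Int.cast_natCast]

theorem emb_mul_emb (y y' : ZMod p) : emb p n y * emb p n y' = 0 := by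
  rw [mul_emb, red_emb, zero_mul, map_zero]

/-- The endomorphism of `C_y × C_p` with a given matrix. -/
def endo (u : ZMod (p ^ n)) (v w k : ZMod p) : CyCp p n →* CyCp p n where
  toFun z := (.ofAdd (u * z.1.toAdd + emb p n (v * z.2.toAdd)),
    .ofAdd (w * red p n z.1.toAdd + k * z.2.toAdd))
  map_one' := by simp
  map_mul' z z' := by
    refine Prod.ext (congrArg Multiplicative.ofAdd ?_) (congrArg Multiplicative.ofAdd ?_)
    · change u * (z.1.toAdd + z'.1.toAdd) + emb p n (v * (z.2.toAdd + z'.2.toAdd)) =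
        (u * z.1.toAdd + emb p n (v * z.2.toAdd)) + (u * z'.1.toAdd + emb p n (v * z'.2.toAdd))
      rw [mul_add v, map_add]
      ring
    · change w * red p n (z.1.toAdd + z'.1.toAdd) + k * (z.2.toAdd + z'.2.toAdd) =
        (w * red p n z.1.toAdd + k * z.2.toAdd) + (w * red p n z'.1.toAdd + k * z'.2.toAdd)
      rw [map_add]
      ring

/-- The matrix product. The lower right entry is only `k * k'`, because the term `w * red (emb v')`
vanishes by `red_emb`. -/
theorem endo_endo (u u' : ZMod (p ^ n)) (v w k v' w' k' : ZMod p) (z : CyCp p n) :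
    endo u v w k (endo u' v' w' k' z) = endo (u * u' + emb p n (v * w'))
      (red p n u * v' + v * k') (w * red p n u' + k * w') (k * k') z := by
  refine Prod.ext (congrArg Multiplicative.ofAdd ?_) (congrArg Multiplicative.ofAdd ?_)
  · change u * (u' * z.1.toAdd + emb p n (v' * z.2.toAdd)) +
      emb p n (v * (w' * red p n z.1.toAdd + k' * z.2.toAdd)) =
      (u * u' + emb p n (v * w')) * z.1.toAdd +
      emb p n ((red p n u * v' + v * k') * z.2.toAdd)
    have h1 := mul_emb u (v' * z.2.toAdd)
    have h2 := mul_emb z.1.toAdd (v * w')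
    have h3 : v * (w' * red p n z.1.toAdd + k' * z.2.toAdd) =
      red p n z.1.toAdd * (v * w') + v * k' * z.2.toAdd := by ring
    have h4 : (red p n u * v' + v * k') * z.2.toAdd =
      red p n u * (v' * z.2.toAdd) + v * k' * z.2.toAdd := by ring
    rw [h3, h4, map_add, map_add, ← h1, ← h2]
    ring
  · change w * red p n (u' * z.1.toAdd + emb p n (v' * z.2.toAdd)) +
      k * (w' * red p n z.1.toAdd + k' * z.2.toAdd) =
      (w * red p n u' + k * w') * red p n z.1.toAdd + k * k' * z.2.toAdd
    rw [map_add, map_mul, red_emb]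
    ring

theorem endo_one (z : CyCp p n) : endo 1 0 0 1 z = z := by
  refine Prod.ext (congrArg Multiplicative.ofAdd ?_) (congrArg Multiplicative.ofAdd ?_)
  · change 1 * z.1.toAdd + emb p n (0 * z.2.toAdd) = z.1.toAdd
    simp
  · change 0 * red p n z.1.toAdd + 1 * z.2.toAdd = z.2.toAdd
    simp

variable (u : ZMod (p ^ n)) (v w k : ZMod p)

theorem endo_P : endo u v w k (CyCp.P p n) = (.ofAdd u, .ofAdd w) := by
  refine Prod.ext (congrArg Multiplicative.ofAdd ?_) (congrArg Multiplicative.ofAdd ?_)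
  · change u * 1 + emb p n (v * 0) = u
    simp
  · change w * red p n 1 + k * 0 = w
    simp

theorem endo_Q : endo u v w k (CyCp.Q p n) = (.ofAdd (emb p n v), .ofAdd k) := by
  refine Prod.ext (congrArg Multiplicative.ofAdd ?_) (congrArg Multiplicative.ofAdd ?_)
  · change u * 0 + emb p n (v * 1) = _
    simp
  · change w * red p n 0 + k * 1 = k
    simp

theorem cycp_hom_ext {p n : ℕ} {K : Type} [Group K] {F F' : CyCp p n →* K}
    (hP : F (CyCp.P p n) = F' (CyCp.P p n)) (hQ : F (CyCp.Q p n) = F' (CyCp.Q p n)) : F = F' :=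
  prod_hom_ext (cyc_hom_ext hP) (cyc_hom_ext hQ)

theorem endo_inj [Fact p.Prime] {u u' : ZMod (p ^ n)} {v w k v' w' k' : ZMod p}
    (h : ∀ z, endo u v w k z = endo u' v' w' k' z) : u = u' ∧ v = v' ∧ w = w' ∧ k = k' := by
  have hP := h (CyCp.P p n)
  have hQ := h (CyCp.Q p n)
  rw [endo_P, endo_P, Prod.mk.injEq] at hP
  rw [endo_Q, endo_Q, Prod.mk.injEq] at hQ
  exact ⟨Multiplicative.ofAdd.injective hP.1,
    emb_injective (Multiplicative.ofAdd.injective hQ.1),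
    Multiplicative.ofAdd.injective hP.2, Multiplicative.ofAdd.injective hQ.2⟩

theorem cycp_P_pow {p n : ℕ} (k : ℕ) :
    CyCp.P p n ^ k = (.ofAdd (k : ZMod (p ^ n)), .ofAdd 0) := by
  rw [CyCp.P, Prod.pow_mk, cyc_gen_pow_eq_ofAdd, one_pow, ofAdd_zero]

theorem cycp_Q_pow {p n : ℕ} (k : ℕ) :
    CyCp.Q p n ^ k = (.ofAdd 0, .ofAdd (k : ZMod p)) := by
  rw [CyCp.Q, Prod.pow_mk, cyc_gen_pow_eq_ofAdd, one_pow, ofAdd_zero]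

theorem cycp_P_zpow {p n : ℕ} (k : ℤ) :
    CyCp.P p n ^ k = (.ofAdd (k : ZMod (p ^ n)), .ofAdd 0) := by
  rw [CyCp.P, Prod.pow_def, cyc_gen_zpow_eq_ofAdd, one_zpow, ofAdd_zero]

theorem cycp_Q_zpow {p n : ℕ} (k : ℤ) :
    CyCp.Q p n ^ k = (.ofAdd 0, .ofAdd (k : ZMod p)) := by
  rw [CyCp.Q, Prod.pow_def, cyc_gen_zpow_eq_ofAdd, one_zpow, ofAdd_zero]

/-- Every endomorphism of `C_y × C_p` has a matrix. -/
theorem exists_eq_endo [Fact p.Prime] (F : CyCp p n →* CyCp p n) : ∃ u v w k, F = endo u v w k := by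
  -- The image of `Q` is killed by `p`, and the `p`-torsion of `ZMod (p ^ n)` is the image of `emb`.
  have hq : p • (F (CyCp.Q p n)).1.toAdd = 0 := by
    have : F (CyCp.Q p n) ^ p = 1 := by
      rw [← map_pow, cycp_Q_pow, ZMod.natCast_self]
      exact map_one F
    exact congrArg (fun z => Multiplicative.toAdd z.1) this
  obtain ⟨v, hv⟩ := exists_emb_eq hq
  refine ⟨(F (CyCp.P p n)).1.toAdd, v, (F (CyCp.P p n)).2.toAdd, (F (CyCp.Q p n)).2.toAdd,
    cycp_hom_ext ?_ ?_⟩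
  · rw [endo_P]; rfl
  · rw [endo_Q, hv]; rfl

/-- The diagonal automorphisms. -/
def autDiag (p n : ℕ) [Fact (1 < n)] : (ZMod (p ^ n))ˣ × (ZMod p)ˣ →* MulAut (CyCp p n) :=
  mulAutOfEnd (fun g => endo (g.1 : ZMod (p ^ n)) 0 0 (g.2 : ZMod p))
    (fun z => by simpa using endo_one z)
    (fun g h z => by simp [endo_endo])

/-- The automorphisms that fix `P` and move `Q` by a power of `P`. -/
def autUpper (p n : ℕ) [Fact (1 < n)] : Cyc p →* MulAut (CyCp p n) :=
  mulAutOfEnd (fun v => endo 1 v.toAdd 0 1)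
    (fun z => by simpa using endo_one z)
    (fun g h z => by simp [endo_endo, add_comm])

/-- The automorphisms that fix `Q` and move `P` by a power of `Q`. -/
def autLower (p n : ℕ) [Fact (1 < n)] : Cyc p →* MulAut (CyCp p n) :=
  mulAutOfEnd (fun w => endo 1 0 w.toAdd 1)
    (fun z => by simpa using endo_one z)
    (fun g h z => by simp [endo_endo])

theorem autDiag_apply (g : (ZMod (p ^ n))ˣ × (ZMod p)ˣ) (z : CyCp p n) :
    autDiag p n g z = endo (g.1 : ZMod (p ^ n)) 0 0 (g.2 : ZMod p) z := rfl

theorem autUpper_apply (v : Cyc p) (z : CyCp p n) :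
    autUpper p n v z = endo 1 v.toAdd 0 1 z := rfl

theorem autLower_apply (w : Cyc p) (z : CyCp p n) :
    autLower p n w z = endo 1 0 w.toAdd 1 z := rfl

/-- With `ε = emb p n y` one has `u * u' = 1 - ε` and `ε ^ 2 = 0`, so `1 + ε` inverts the right
side. -/
theorem isUnit_of_isUnit_mul_add_emb {u u' : ZMod (p ^ n)} {y : ZMod p}
    (h : u * u' + emb p n y = 1) : IsUnit u := by
  refine IsUnit.of_mul_eq_one (u' * (1 + emb p n y)) ?_
  have := emb_mul_emb (n := n) y y
  linear_combination (1 + emb p n y) * h - this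

/-- Every automorphism is a product of diagonal, lower and upper ones. -/
theorem exists_eq_autDiag_mul [Fact p.Prime] (σ : MulAut (CyCp p n)) :
    ∃ g w v, σ = autDiag p n g * autLower p n w * autUpper p n v := by
  obtain ⟨u, v, w, k, h⟩ := exists_eq_endo σ.toMonoidHom
  obtain ⟨u', v', w', k', h'⟩ := exists_eq_endo σ⁻¹.toMonoidHom
  have hσ : ∀ z, σ z = endo u v w k z := fun z => DFunLike.congr_fun h z
  have hσ' : ∀ z, σ⁻¹ z = endo u' v' w' k' z := fun z => DFunLike.congr_fun h' z
  have hid : ∀ z, endo u v w k (endo u' v' w' k' z) = endo 1 0 0 1 z := fun z => by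
    rw [← hσ, ← hσ', MulAut.apply_inv_self, endo_one]
  simp only [endo_endo] at hid
  obtain ⟨h1, -, -, h4⟩ := endo_inj hid
  obtain ⟨u, rfl⟩ := isUnit_of_isUnit_mul_add_emb h1
  obtain ⟨k, rfl⟩ := IsUnit.of_mul_eq_one _ h4
  -- In the order diagonal, lower, upper, the product has entries `u`, `u * v`, `k * w`, `k` with no
  -- correction term, so `v` and `w` need only be divided by `u` and `k`.
  refine ⟨(u, k), .ofAdd (((k⁻¹ : (ZMod p)ˣ) : ZMod p) * w),
    .ofAdd (red p n ((u⁻¹ : (ZMod (p ^ n))ˣ) : ZMod (p ^ n)) * v), MulEquiv.ext fun z => ?_⟩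
  rw [hσ, MulAut.mul_apply, MulAut.mul_apply, autUpper_apply, autLower_apply, autDiag_apply,
    endo_endo, endo_endo]
  have : red p n (u : ZMod (p ^ n)) * red p n ((u⁻¹ : (ZMod (p ^ n))ˣ) : ZMod (p ^ n)) = 1 := by
    rw [← map_mul, Units.mul_inv, map_one]
  simp only [toAdd_ofAdd, mul_one, one_mul, zero_mul, mul_zero, map_zero, add_zero, zero_add,
    map_one, Units.mul_inv_cancel_left, ← mul_assoc (red p n _), this]

end Endomorphisms

/-! ### Normal forms in the central product and in the presented group. -/

theorem qfyc_normalForm {p n : ℕ} [NeZero p] (N : QfYC p n) :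
    ∃ i j k : ℤ, N = QfYC.c p n ^ j * QfYC.b p n ^ i * QfYC.f p n ^ k := by
  obtain ⟨q, y, rfl⟩ := CentralProduct.eq_left_mul_right N
  obtain ⟨k, rfl⟩ := cyc_eq_gen_zpow y
  have ha : QfYC.a p n = QfYC.f p n ^ p ^ (n - 2) := (qfyc_rels p n).2.2.2.2.2.2.2.2.2.2
  -- The power of `a` is absorbed into that of `f` through `a = f ^ p ^ (n - 2)`.
  refine ⟨q.x.val, q.y.val, (p ^ (n - 2) * q.z.val : ℕ) + k, ?_⟩
  rw [Qf.eq_normalForm q, map_mul, map_mul, map_pow, map_pow, map_pow, map_zpow, zpow_add,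
    zpow_natCast, zpow_natCast, zpow_natCast, pow_mul, ← ha, ← mul_assoc]
  rw [← Qf.eq_normalForm q]
  rfl

theorem autPres_normalForm {p n : ℕ} [NeZero p] {s t : ℤ}
    {φ : Cyc (p - 1) →* MulAut (QfYC p n)} (hφ : IsQfYCAction p n s t φ) (g : AutPres p n s t) :
    ∃ i j k l m : ℤ, g = gen p n s t .c ^ j * gen p n s t .b ^ i * gen p n s t .f ^ k *
      gen p n s t .d ^ l * gen p n s t .e ^ m := by
  obtain ⟨Θ, hΘ⟩ := exists_equiv_gensOne hφ
  obtain ⟨i, j, k, hN⟩ := qfyc_normalForm (Θ g).1.left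
  obtain ⟨l, hd⟩ := cyc_eq_gen_zpow (Θ g).1.right
  obtain ⟨m, he⟩ := cyc_eq_gen_zpow (Θ g).2
  refine ⟨i, j, k, l, m, Θ.injective ?_⟩
  simp only [map_mul, map_zpow, hΘ]
  let J : QfYC p n →* (QfYC p n ⋊[φ] Cyc (p - 1)) × Cyc (p - 1) :=
    (MonoidHom.inl _ _).comp SemidirectProduct.inl
  let D : Cyc (p - 1) →* (QfYC p n ⋊[φ] Cyc (p - 1)) × Cyc (p - 1) :=
    (MonoidHom.inl _ _).comp SemidirectProduct.inr
  let E : Cyc (p - 1) →* (QfYC p n ⋊[φ] Cyc (p - 1)) × Cyc (p - 1) := MonoidHom.inr _ _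
  have h1 : Θ g = J (Θ g).1.left * D (Θ g).1.right * E (Θ g).2 := by
    refine Prod.ext ?_ ?_
    · change (Θ g).1 = SemidirectProduct.inl (Θ g).1.left * SemidirectProduct.inr (Θ g).1.right * 1
      rw [mul_one, SemidirectProduct.inl_left_mul_inr_right]
    · change (Θ g).2 = 1 * 1 * (Θ g).2
      rw [one_mul, one_mul]
  rw [h1, hN, hd, he]
  simp only [map_mul, map_zpow]
  rfl

/-! ### The presented group is the automorphism group. -/

section Automorphisms

variable {p n : ℕ} [hn : Fact (1 < n)]

/-- Reduction of units modulo `p`. -/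
def redUnits (p n : ℕ) [Fact (1 < n)] : (ZMod (p ^ n))ˣ →* (ZMod p)ˣ :=
  Units.map (red p n).toMonoidHom

theorem coe_redUnits (u : (ZMod (p ^ n))ˣ) : ((redUnits p n u : (ZMod p)ˣ) : ZMod p) = red p n u :=
  rfl

/-- Conjugation by a diagonal matrix scales the upper entry by the ratio of its two entries modulo
`p`; in `autDiag_mul_autLower` the lower entry is scaled by the inverse ratio. -/
theorem autDiag_mul_autUpper {g : (ZMod (p ^ n))ˣ × (ZMod p)ˣ} {v v' : ZMod p}
    (h : v' * g.2 = red p n g.1 * v) :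
    autDiag p n g * autUpper p n (.ofAdd v) = autUpper p n (.ofAdd v') * autDiag p n g := by
  ext1 z
  rw [MulAut.mul_apply, MulAut.mul_apply, autDiag_apply, autUpper_apply, autUpper_apply,
    autDiag_apply, endo_endo, endo_endo]
  simp [h]

theorem autDiag_mul_autLower {g : (ZMod (p ^ n))ˣ × (ZMod p)ˣ} {w w' : ZMod p}
    (h : w' * red p n g.1 = g.2 * w) :
    autDiag p n g * autLower p n (.ofAdd w) = autLower p n (.ofAdd w') * autDiag p n g := by
  ext1 z
  rw [MulAut.mul_apply, MulAut.mul_apply, autDiag_apply, autLower_apply, autLower_apply,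
    autDiag_apply, endo_endo, endo_endo]
  simp [h]

/-- The two orders of multiplication differ only in the upper left entry, which is `1` or `1 + ε`
with `ε = p ^ (n - 1)`, and `(1 - ε) * (1 + ε) = 1`. This is the relation between `a`, `b` and `c`.
-/
theorem autLower_mul_autUpper {u : (ZMod (p ^ n))ˣ} (h : (u : ZMod (p ^ n)) = 1 - emb p n 1) :
    autLower p n (Cyc.gen p) * autUpper p n (Cyc.gen p) =
      autDiag p n (u, 1) * autUpper p n (Cyc.gen p) * autLower p n (Cyc.gen p) := by
  ext1 z
  simp only [MulAut.mul_apply, autDiag_apply, autUpper_apply, autLower_apply, endo_endo]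
  have h1 : red p n (1 - emb p n 1) = 1 := by rw [map_sub, map_one, red_emb, sub_zero]
  have h2 : (1 - emb p n 1) * (1 + emb p n 1) = 1 := by
    have := emb_mul_emb (p := p) (n := n) 1 1
    linear_combination -this
  simp [h, h1, h2, Cyc.gen]

/-- Uniqueness of the factorisation. The lower row gives `g.2 = 1` and `w = 0`, after which the
upper row can be read off. -/
theorem eq_one_of_autDiag_mul [Fact p.Prime] {g : (ZMod (p ^ n))ˣ × (ZMod p)ˣ} {v w : ZMod p}
    (h : autDiag p n g * autUpper p n (.ofAdd v) * autLower p n (.ofAdd w) = 1) :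
    g = 1 ∧ v = 0 ∧ w = 0 := by
  have h1 : ∀ z, (autDiag p n g * autUpper p n (.ofAdd v) * autLower p n (.ofAdd w)) z =
      endo 1 0 0 1 z := fun z => by rw [h, endo_one]; rfl
  simp only [MulAut.mul_apply, autDiag_apply, autUpper_apply, autLower_apply, endo_endo] at h1
  obtain ⟨h1, h2, h3, h4⟩ := endo_inj h1
  simp only [toAdd_ofAdd, mul_one, one_mul, zero_mul, mul_zero, map_zero, add_zero, zero_add,
    map_one] at h1 h2 h3 h4
  rw [h4, one_mul] at h3
  subst h3
  simp only [mul_zero, map_zero, add_zero, mul_one] at h1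
  rw [h1, map_one, one_mul] at h2
  exact ⟨Prod.ext (Units.ext h1) (Units.ext h4), h2, rfl⟩

/-- The automorphisms `u ↦ u ^ g` of `C_y × C_p` for the generators `g`, in terms of the units
`s`, `x`, `α`. -/
def tau (us : (ZMod p)ˣ) (ux ua : (ZMod (p ^ n))ˣ) : AutGen → MulAut (CyCp p n)
  | .a => autDiag p n (ua ^ p ^ (n - 2), 1)
  | .b => autUpper p n (Cyc.gen p)
  | .c => autLower p n (Cyc.gen p)
  -- The ratio of the entries modulo `p` is `us`, so `b` is scaled by `s` and `c` by its inverse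
  -- `t`.
  | .d => autDiag p n (-1, -us⁻¹)
  | .e => autDiag p n (ux, redUnits p n ux)
  | .f => autDiag p n (ua, 1)

variable {us : (ZMod p)ˣ} {ux ua : (ZMod (p ^ n))ˣ} {s t : ℤ}

/-- The conditions on the units `s`, `x`, `α`. -/
structure UnitParam (p n : ℕ) [Fact (1 < n)] (us : (ZMod p)ˣ) (ux ua : (ZMod (p ^ n))ˣ)
    (s t : ℤ) : Prop where
  s_order : orderOf us = p - 1
  s_eq : (s : ZMod p) = us
  t_eq : (t : ZMod p) = (us⁻¹ : (ZMod p)ˣ)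
  x_order : orderOf ux = p - 1
  a_order : orderOf ua = p ^ (n - 1)
  a_red : redUnits p n ua = 1
  x_red_order : orderOf (redUnits p n ux) = p - 1
  a_pow : ((ua ^ p ^ (n - 2) : (ZMod (p ^ n))ˣ) : ZMod (p ^ n)) = 1 - emb p n 1
  even : Even (p - 1)

theorem commute_diag_upper {g : (ZMod (p ^ n))ˣ × (ZMod p)ˣ} (h : redUnits p n g.1 = g.2) :
    Commute (autDiag p n g) (autUpper p n (Cyc.gen p)) :=
  autDiag_mul_autUpper (by rw [← h, coe_redUnits, mul_one, one_mul])

theorem commute_diag_lower {g : (ZMod (p ^ n))ˣ × (ZMod p)ˣ} (h : redUnits p n g.1 = g.2) :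
    Commute (autDiag p n g) (autLower p n (Cyc.gen p)) :=
  autDiag_mul_autLower (by rw [← h, coe_redUnits, mul_one, one_mul])

/-- `tau` records `u ↦ u ^ g`, a right action. Passing to inverses restores the order of products
and gives a homomorphism. -/
theorem tau_inv_holds (h : UnitParam p n us ux ua s t) :
    AutRelsHold p n s t (fun g => (tau us ux ua g)⁻¹) := by
  have hs : us ^ (p - 1) = 1 := by rw [← h.s_order, pow_orderOf_eq_one]
  have hx : ux ^ (p - 1) = 1 := by rw [← h.x_order, pow_orderOf_eq_one]
  have ha : ua ^ p ^ (n - 1) = 1 := by rw [← h.a_order, pow_orderOf_eq_one]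
  have hn1 : p ^ (n - 2) * p = p ^ (n - 1) := by
    rw [← pow_succ]; congr 1; have := hn.out; omega
  have har : redUnits p n (ua ^ p ^ (n - 2)) = 1 := by rw [map_pow, h.a_red, one_pow]
  have comm : ∀ g g' : (ZMod (p ^ n))ˣ × (ZMod p)ˣ,
      Commute (autDiag p n g)⁻¹ (autDiag p n g')⁻¹ := fun g g' =>
    ((Commute.all g g').map _).inv_inv
  have powD : ∀ (g : (ZMod (p ^ n))ˣ × (ZMod p)ˣ) (k : ℕ), g ^ k = 1 →
      (autDiag p n g)⁻¹ ^ k = 1 := fun g k hg => by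
    rw [inv_pow, ← map_pow, hg, map_one, inv_one]
  exact
    { a_pow := powD _ _ (by rw [Prod.pow_mk, ← pow_mul, hn1, ha, one_pow]; rfl)
      b_pow := by
        change (autUpper p n (Cyc.gen p))⁻¹ ^ p = 1
        rw [inv_pow, ← map_pow, cyc_gen_pow, map_one, inv_one]
      c_pow := by
        change (autLower p n (Cyc.gen p))⁻¹ ^ p = 1
        rw [inv_pow, ← map_pow, cyc_gen_pow, map_one, inv_one]
      ab := (commute_diag_upper har).inv_inv
      ac := (commute_diag_lower har).inv_inv
      bc := by
        -- Inverting both sides turns the relation into one between the matrices themselves.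
        rw [← inv_inj, mul_inv_rev, mul_inv_rev, mul_inv_rev, inv_inv, inv_inv, inv_inv]
        exact (autLower_mul_autUpper h.a_pow).trans (mul_assoc _ _ _)
      f_pow := powD _ _ (by rw [Prod.pow_mk, ha, one_pow]; rfl)
      af := comm _ _
      bf := (commute_diag_upper h.a_red).symm.inv_inv
      cf := (commute_diag_lower h.a_red).symm.inv_inv
      a_eq := by
        change (autDiag p n _)⁻¹ = (autDiag p n _)⁻¹ ^ _
        rw [inv_pow, ← map_pow, Prod.pow_mk, one_pow]
      d_pow := powD _ _ (by
        rw [Prod.pow_mk, h.even.neg_pow, h.even.neg_pow, one_pow, inv_pow, hs, inv_one]; rfl)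
      ad := comm _ _
      bd := by
        change (autDiag p n _)⁻¹⁻¹ * (autUpper p n _)⁻¹ * (autDiag p n _)⁻¹ =
          (autUpper p n _)⁻¹ ^ s
        rw [← inv_inj, mul_inv_rev, mul_inv_rev, inv_inv, inv_inv, inv_zpow, inv_inv,
          ← mul_assoc, mul_inv_eq_iff_eq_mul, ← map_zpow, cyc_gen_zpow_eq_ofAdd]
        refine autDiag_mul_autUpper ?_
        simp [h.s_eq]
      cd := by
        change (autDiag p n _)⁻¹⁻¹ * (autLower p n _)⁻¹ * (autDiag p n _)⁻¹ =
          (autLower p n _)⁻¹ ^ t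
        rw [← inv_inj, mul_inv_rev, mul_inv_rev, inv_inv, inv_inv, inv_zpow, inv_inv,
          ← mul_assoc, mul_inv_eq_iff_eq_mul, ← map_zpow, cyc_gen_zpow_eq_ofAdd]
        refine autDiag_mul_autLower ?_
        simp [h.t_eq]
      df := comm _ _
      e_pow := powD _ _ (by rw [Prod.pow_mk, ← map_pow, hx, map_one]; rfl)
      ae := comm _ _
      be := (commute_diag_upper rfl).symm.inv_inv
      ce := (commute_diag_lower rfl).symm.inv_inv
      de := comm _ _
      ef := comm _ _ }

/-- The homomorphism from the presented group to the automorphism group. -/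
def autHom (h : UnitParam p n us ux ua s t) : AutPres p n s t →* MulAut (CyCp p n) :=
  autLift (tau_inv_holds h)

theorem autHom_gen (h : UnitParam p n us ux ua s t) (g : AutGen) :
    autHom h (gen p n s t g) = (tau us ux ua g)⁻¹ := autLift_gen _ _

theorem autHom_injective [Fact p.Prime] (h : UnitParam p n us ux ua s t) :
    Function.Injective (autHom h) := by
  rw [injective_iff_map_eq_one]
  intro g hg
  have hs : us ^ (p - 1) = 1 := by rw [← h.s_order, pow_orderOf_eq_one]
  have H := gen_holds p n s t
  obtain ⟨φ, hφ⟩ := exists_isQfYCAction n hs h.s_eq h.t_eq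
  obtain ⟨i, j, k, l, m, rfl⟩ := autPres_normalForm hφ g
  -- The inverse of the image of the normal form is already a diagonal, upper, lower product.
  have e1 : (autDiag p n (ux, redUnits p n ux) ^ m * autDiag p n (-1, -us⁻¹) ^ l *
      autDiag p n (ua, 1) ^ k) * autUpper p n (Cyc.gen p) ^ i * autLower p n (Cyc.gen p) ^ j = 1 := by
    rw [← inv_inj, inv_one, ← hg]
    simp only [map_mul, map_zpow, autHom_gen, tau, mul_inv_rev, inv_zpow, mul_assoc]
  rw [← map_zpow, ← map_zpow, ← map_zpow, ← map_mul, ← map_mul, ← map_zpow, ← map_zpow,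
    cyc_gen_zpow_eq_ofAdd, cyc_gen_zpow_eq_ofAdd] at e1
  obtain ⟨e2, hi, hj⟩ := eq_one_of_autDiag_mul e1
  rw [Prod.ext_iff] at e2
  obtain ⟨e2, e3⟩ := e2
  change ux ^ m * (-1) ^ l * ua ^ k = 1 at e2
  change redUnits p n ux ^ m * (-us⁻¹) ^ l * 1 ^ k = 1 at e3
  rw [one_zpow, mul_one] at e3
  have e4 := congrArg (redUnits p n) e2
  have hneg : redUnits p n (-1) = -1 := Units.ext (by simp [redUnits])
  rw [map_mul, map_mul, map_zpow, map_zpow, map_zpow, h.a_red, one_zpow, mul_one, map_one,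
    hneg] at e4
  -- The first diagonal entry reduced modulo `p` and the second one differ exactly by the factor `us
  -- ^ l`, up to inversion.
  have e5 : us ^ l = 1 := by
    have : (-us⁻¹) ^ l = (-1) ^ l * (us ^ l)⁻¹ := by rw [← inv_zpow, ← mul_zpow, neg_one_mul]
    rw [this, ← mul_assoc, e4, one_mul, inv_eq_one] at e3
    exact e3
  have hl : ((p - 1 : ℕ) : ℤ) ∣ l := by
    rw [← h.s_order]; exact orderOf_dvd_iff_zpow_eq_one.2 e5
  -- As `p - 1` is even, the signs contributed by `d` disappear, which separates `x` from `α`.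
  have hl2 : Even l := by
    obtain ⟨q, rfl⟩ := hl
    exact ((Int.even_coe_nat _).2 h.even).mul_right q
  rw [hl2.neg_zpow, one_zpow, mul_one] at e2 e4
  have hm : ((p - 1 : ℕ) : ℤ) ∣ m := by
    rw [← h.x_red_order]; exact orderOf_dvd_iff_zpow_eq_one.2 e4
  have e6 : ux ^ m = 1 := by
    rw [← h.x_order] at hm; exact orderOf_dvd_iff_zpow_eq_one.1 hm
  rw [e6, one_mul] at e2
  have hk : ((p ^ (n - 1) : ℕ) : ℤ) ∣ k := by
    rw [← h.a_order]; exact orderOf_dvd_iff_zpow_eq_one.2 e2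
  rw [ZMod.intCast_zmod_eq_zero_iff_dvd] at hi hj
  have zp : ∀ (g : AutPres p n s t) (N : ℕ) (r : ℤ), g ^ N = 1 → (N : ℤ) ∣ r → g ^ r = 1 := by
    rintro g N _ hg ⟨r, rfl⟩
    rw [zpow_mul, zpow_natCast, hg, one_zpow]
  rw [zp _ _ _ H.c_pow hj, zp _ _ _ H.b_pow hi, zp _ _ _ H.f_pow hk, zp _ _ _ H.d_pow hl,
    zp _ _ _ H.e_pow hm]
  simp

/-- A cyclic group has at most `N` solutions of `w ^ N = 1`; for `N = orderOf u` the powers of `u`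
already supply `N` of them. -/
theorem mem_zpowers_of_pow_eq_one {G : Type} [CommGroup G] [Finite G] [IsCyclic G] {u w : G}
    (h : w ^ orderOf u = 1) : w ∈ Subgroup.zpowers u := by
  classical
  have := Fintype.ofFinite G
  have h1 := IsCyclic.card_pow_eq_one_le (α := G) (orderOf_pos u)
  have h2 : (Subgroup.zpowers u : Set G).toFinset ⊆
      Finset.univ.filter (fun a : G => a ^ orderOf u = 1) := by
    intro a ha
    rw [Set.mem_toFinset] at ha
    obtain ⟨k, rfl⟩ := ha
    simp only [Finset.mem_filter, Finset.mem_univ, true_and]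
    rw [← zpow_natCast, ← zpow_mul, mul_comm, zpow_mul, zpow_natCast, pow_orderOf_eq_one, one_zpow]
  have h3 : (Subgroup.zpowers u : Set G).toFinset.card = orderOf u := by
    rw [Set.toFinset_card]
    exact Fintype.card_zpowers
  have h4 := Finset.eq_of_subset_of_card_le h2 (by rw [h3]; exact h1)
  have : w ∈ (Subgroup.zpowers u : Set G).toFinset := by
    rw [h4]; simpa using h
  simpa using this

/-- Each `p`-th power gains a factor `p` in the congruence to `1`. -/
theorem pow_eq_one_of_redUnits_eq_one [Fact p.Prime] {w : (ZMod (p ^ n))ˣ}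
    (h : redUnits p n w = 1) : w ^ p ^ (n - 1) = 1 := by
  obtain ⟨k, hk⟩ := ZMod.intCast_surjective (w : ZMod (p ^ n))
  have h1 : (k : ZMod p) = 1 := by
    rw [← red_intCast (n := n), hk, ← coe_redUnits, h, Units.val_one]
  have h2 : (p : ℤ) ∣ k - 1 := by
    rw [← ZMod.intCast_zmod_eq_zero_iff_dvd]; simp [h1]
  have h3 := dvd_sub_pow_of_dvd_sub h2 (n - 1)
  rw [Nat.sub_add_cancel hn.out.le, one_pow, ← Nat.cast_pow,
    ← ZMod.intCast_zmod_eq_zero_iff_dvd] at h3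
  ext
  rw [Units.val_pow_eq_pow_val, ← hk]
  simpa [sub_eq_zero] using h3

theorem autHom_surjective [hp : Fact p.Prime] (h : UnitParam p n us ux ua s t) (hp2 : p ≠ 2) :
    Function.Surjective (autHom h) := by
  have := ZMod.isCyclic_units_of_prime_pow p hp.out hp2 n
  have : NeZero (p ^ n) := ⟨pow_ne_zero _ hp.out.ne_zero⟩
  have hτ : ∀ g, tau us ux ua g ∈ (autHom h).range := fun g =>
    ⟨(gen p n s t g)⁻¹, by rw [map_inv, autHom_gen, inv_inv]⟩
  have card_eq : Nat.card (ZMod p)ˣ = p - 1 := by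
    rw [Nat.card_eq_fintype_card, ZMod.card_units]
  have hgen : ∀ u : (ZMod p)ˣ, orderOf u = p - 1 → ∀ w, w ∈ Subgroup.zpowers u := fun u hu w =>
    mem_zpowers_of_pow_eq_one (by rw [hu, ← card_eq, pow_card_eq_one'])
  have hD : ∀ g, autDiag p n g ∈ (autHom h).range := by
    rintro ⟨g₁, g₂⟩
    -- `e` and `f` do not change the ratio of the entries modulo `p`, so it determines the power of
    -- `d`; the second entry then determines that of `e`.
    obtain ⟨l, hl⟩ := hgen us h.s_order (redUnits p n g₁ * g₂⁻¹)
    obtain ⟨m, hm⟩ := hgen _ h.x_red_order (g₂ * ((-us⁻¹) ^ l)⁻¹)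
    change us ^ l = _ at hl
    change redUnits p n ux ^ m = _ at hm
    have hneg : redUnits p n (-1) = -1 := Units.ext (by simp [redUnits])
    have hr : redUnits p n (g₁ * (ux ^ m * (-1) ^ l)⁻¹) = 1 := by
      have e1 : (-us⁻¹) ^ l = (-1) ^ l * (us ^ l)⁻¹ := by
        rw [← inv_zpow, ← mul_zpow, neg_one_mul]
      have e2 : (-1 : (ZMod p)ˣ) ^ l * (-1) ^ l = 1 := by
        rw [← mul_zpow, neg_mul_neg, one_mul, one_zpow]
      rw [map_mul, map_inv, map_mul, map_zpow, map_zpow, hneg, hm, e1, hl, mul_inv_eq_one]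
      have e3 : ((-1 : (ZMod p)ˣ) ^ l)⁻¹ * (-1) ^ l = 1 := inv_mul_cancel _
      calc redUnits p n g₁ = g₂ * (redUnits p n g₁ * g₂⁻¹) * (((-1 : (ZMod p)ˣ) ^ l)⁻¹ * (-1) ^ l) := by
            rw [e3, mul_one, mul_comm g₂, inv_mul_cancel_right]
        _ = _ := by rw [mul_inv_rev, inv_inv]; simp only [mul_assoc]
    -- What remains of the first entry is congruent to `1` modulo `p`, so it is killed by `p ^ (n -
    -- 1)`, the order of `ua`. The unit group is cyclic because `p` is odd.
    have hw := mem_zpowers_of_pow_eq_one (u := ua)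
      (by rw [h.a_order]; exact pow_eq_one_of_redUnits_eq_one hr)
    obtain ⟨k, hk⟩ := hw
    change ua ^ k = _ at hk
    have : ((g₁, g₂) : (ZMod (p ^ n))ˣ × (ZMod p)ˣ) =
        (ua, 1) ^ k * ((ux, redUnits p n ux) ^ m * (-1, -us⁻¹) ^ l) := by
      refine Prod.ext ?_ ?_
      · change g₁ = ua ^ k * (ux ^ m * (-1) ^ l)
        rw [hk, inv_mul_cancel_right]
      · change g₂ = 1 ^ k * (redUnits p n ux ^ m * (-us⁻¹) ^ l)
        rw [one_zpow, one_mul, hm, inv_mul_cancel_right]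
    rw [this, map_mul, map_mul, map_zpow, map_zpow, map_zpow]
    exact mul_mem (zpow_mem (hτ .f) k) (mul_mem (zpow_mem (hτ .e) m) (zpow_mem (hτ .d) l))
  intro σ
  obtain ⟨g, w, v, rfl⟩ := exists_eq_autDiag_mul σ
  obtain ⟨i, rfl⟩ := cyc_eq_gen_zpow v
  obtain ⟨j, rfl⟩ := cyc_eq_gen_zpow w
  rw [map_zpow, map_zpow]
  exact mul_mem (mul_mem (hD g) (zpow_mem (hτ .c) j)) (zpow_mem (hτ .b) i)

end Automorphisms

/-! ### The presentation of the holomorph. -/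

section Holomorph

variable {K : Type} [Group K] {p n : ℕ} {s t x af yd ye : ℤ}

/-- The elements `v P, v Q, v a, …, v f` of a group satisfy the relations of the presentation of
`Hol(C_y × C_p)`. -/
structure HolRelsHold (p n : ℕ) (s t x af yd ye : ℤ) (v : HolGen → K) : Prop where
  aut : AutRelsHold p n s t (fun g => v (.aut g))
  P_pow : v .P ^ p ^ n = 1
  Q_pow : v .Q ^ p = 1
  PQ : Commute (v .P) (v .Q)
  Pa : conjBy (v .P) (v (.aut .a)) = v .P ^ ((p - 1) * p ^ (n - 1) + 1)
  Qa : conjBy (v .Q) (v (.aut .a)) = v .Q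
  Pb : conjBy (v .P) (v (.aut .b)) = v .P
  Qb : conjBy (v .Q) (v (.aut .b)) = v .P ^ p ^ (n - 1) * v .Q
  Pc : conjBy (v .P) (v (.aut .c)) = v .P * v .Q
  Qc : conjBy (v .Q) (v (.aut .c)) = v .Q
  Pd : conjBy (v .P) (v (.aut .d)) = (v .P)⁻¹
  Qd : conjBy (v .Q) (v (.aut .d)) = v .Q ^ yd
  Pe : conjBy (v .P) (v (.aut .e)) = v .P ^ x
  Qe : conjBy (v .Q) (v (.aut .e)) = v .Q ^ ye
  Pf : conjBy (v .P) (v (.aut .f)) = v .P ^ af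
  Qf : conjBy (v .Q) (v (.aut .f)) = v .Q

theorem holRelsHold_iff (v : HolGen → K) :
    (∀ r ∈ holRels p n s t x af yd ye, FreeGroup.lift v r = 1) ↔
      HolRelsHold p n s t x af yd ye v := by
  have h0 : (∀ r ∈ autRels p n s t, FreeGroup.lift v (FreeGroup.map HolGen.aut r) = 1) ↔
      AutRelsHold p n s t (fun g => v (.aut g)) := by
    rw [← autRelsHold_iff]
    refine forall₂_congr fun r _ => ?_
    have : (FreeGroup.lift v).comp (FreeGroup.map HolGen.aut) =
        FreeGroup.lift fun g => v (.aut g) := by ext g; simp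
    rw [← this]; rfl
  simp only [holRels, Set.mem_union, or_imp, forall_and, Set.forall_mem_image, h0,
    Set.mem_insert_iff, Set.mem_singleton_iff, forall_eq,
    map_mul, map_pow, map_zpow, map_inv, map_comm, map_conjBy, FreeGroup.lift_apply_of,
    comm_eq_one_iff, zpow_neg, mul_eq_one_iff_eq_inv (a := conjBy _ _), inv_inv]
  constructor
  · rintro ⟨h, h1, h2, h3, h4, h5, h6, h7, h8, h9, h10, h11, h12, h13, h14, h15⟩
    exact ⟨h, h1, h2, h3, h4, h5, h6, h7, h8, h9, h10, h11, h12, h13, h14, h15⟩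
  · rintro ⟨h, h1, h2, h3, h4, h5, h6, h7, h8, h9, h10, h11, h12, h13, h14, h15⟩
    exact ⟨h, h1, h2, h3, h4, h5, h6, h7, h8, h9, h10, h11, h12, h13, h14, h15⟩

/-- The group presented by the relations of `Hol(C_y × C_p)`. -/
abbrev HolPres (p n : ℕ) (s t x af yd ye : ℤ) : Type :=
  PresentedGroup (holRels p n s t x af yd ye)

theorem holPres_holds (p n : ℕ) (s t x af yd ye : ℤ) :
    HolRelsHold p n s t x af yd ye
      (fun g => (PresentedGroup.of g : HolPres p n s t x af yd ye)) := by
  rw [← holRelsHold_iff]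
  intro r hr
  rw [← PresentedGroup.one_of_mem hr]
  congr 1
  ext g
  rw [FreeGroup.lift_apply_of]
  rfl

/-- The images of the generators in the holomorph. -/
def holGens (Φ : AutPres p n s t →* MulAut (CyCp p n)) : HolGen → Hol (CyCp p n)
  | .P => SemidirectProduct.inl (CyCp.P p n)
  | .Q => SemidirectProduct.inl (CyCp.Q p n)
  | .aut g => SemidirectProduct.inr (Φ (gen p n s t g))

theorem conjBy_inl_inr {A : Type} [Group A] (z : A) (σ : MulAut A) :
    conjBy (SemidirectProduct.inl z : Hol A) (SemidirectProduct.inr σ) =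
      SemidirectProduct.inl (σ⁻¹ z) := by
  have := SemidirectProduct.inl_aut_inv (φ := MonoidHom.id (MulAut A)) σ z
  rw [map_inv] at this
  exact this.symm

theorem AutRelsHold.map {G : Type} [Group G] {v : AutGen → G} (h : AutRelsHold p n s t v)
    (F : G →* K) : AutRelsHold p n s t (fun g => F (v g)) := by
  have := autRelsHold_of_hom (F.comp (FreeGroup.lift v)) (p := p) (n := n) (s := s) (t := t)
    (fun r hr => by rw [MonoidHom.comp_apply, (autRelsHold_iff v).2 h r hr, map_one])
  simpa using this

theorem holGens_holds {Φ : AutPres p n s t →* MulAut (CyCp p n)}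
    (hΦ : IsTable p n x af yd ye (fun g => Φ (gen p n s t g))) :
    HolRelsHold p n s t x af yd ye (holGens Φ) := by
  let I : CyCp p n →* Hol (CyCp p n) := SemidirectProduct.inl
  have hI : ∀ z g, conjBy (I z) (holGens Φ (.aut g)) = I ((Φ (gen p n s t g))⁻¹ z) :=
    fun z g => conjBy_inl_inr _ _
  exact
    { aut := ((gen_holds p n s t).map Φ).map SemidirectProduct.inr
      P_pow := (map_pow I _ _).symm.trans (by
        rw [cycp_P_pow, ZMod.natCast_self]; exact map_one I)
      Q_pow := (map_pow I _ _).symm.trans (by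
        rw [cycp_Q_pow, ZMod.natCast_self]; exact map_one I)
      PQ := (Commute.all (CyCp.P p n) (CyCp.Q p n)).map I
      Pa := (hI _ _).trans (by rw [hΦ.P_a, map_pow]; rfl)
      Qa := (hI _ _).trans (by rw [hΦ.Q_a]; rfl)
      Pb := (hI _ _).trans (by rw [hΦ.P_b]; rfl)
      Qb := (hI _ _).trans (by rw [hΦ.Q_b, map_mul, map_pow]; rfl)
      Pc := (hI _ _).trans (by rw [hΦ.P_c, map_mul]; rfl)
      Qc := (hI _ _).trans (by rw [hΦ.Q_c]; rfl)
      Pd := (hI _ _).trans (by rw [hΦ.P_d, map_inv]; rfl)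
      Qd := (hI _ _).trans (by rw [hΦ.Q_d, map_zpow]; rfl)
      Pe := (hI _ _).trans (by rw [hΦ.P_e, map_zpow]; rfl)
      Qe := (hI _ _).trans (by rw [hΦ.Q_e, map_zpow]; rfl)
      Pf := (hI _ _).trans (by rw [hΦ.P_f, map_zpow]; rfl)
      Qf := (hI _ _).trans (by rw [hΦ.Q_f]; rfl) }

/-- The abelian normal subgroup generated by `P` and `Q` is an image of `C_y × C_p`. -/
def HolRelsHold.baseHom {v : HolGen → K} (h : HolRelsHold p n s t x af yd ye v) :
    CyCp p n →* K :=
  (cycLift _ (v .P) h.P_pow).noncommCoprod (cycLift _ (v .Q) h.Q_pow)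
    (fun y z => commute_cycLift _ (commute_cycLift _ h.PQ.symm y).symm z)

theorem HolRelsHold.baseHom_P {v : HolGen → K} (h : HolRelsHold p n s t x af yd ye v) :
    h.baseHom (CyCp.P p n) = v .P := by
  simp [baseHom, CyCp.P]

theorem HolRelsHold.baseHom_Q {v : HolGen → K} (h : HolRelsHold p n s t x af yd ye v) :
    h.baseHom (CyCp.Q p n) = v .Q := by
  simp [baseHom, CyCp.Q]

theorem HolRelsHold.baseHom_conj {v : HolGen → K} (h : HolRelsHold p n s t x af yd ye v)
    {τ : AutGen → MulAut (CyCp p n)} (hτ : IsTable p n x af yd ye τ) (g : AutGen)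
    (z : CyCp p n) :
    h.baseHom ((τ g)⁻¹ z) = (v (.aut g))⁻¹ * h.baseHom z * v (.aut g) := by
  have : h.baseHom.comp (τ g)⁻¹.toMonoidHom =
      (MulAut.conj (v (.aut g))⁻¹).toMonoidHom.comp h.baseHom := by
    have hP : conjBy (v .P) (v (.aut g)) =
        (MulAut.conj (v (.aut g))⁻¹).toMonoidHom.comp h.baseHom (CyCp.P p n) := by
      simp [h.baseHom_P, conjBy]
    have hQ : conjBy (v .Q) (v (.aut g)) =
        (MulAut.conj (v (.aut g))⁻¹).toMonoidHom.comp h.baseHom (CyCp.Q p n) := by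
      simp [h.baseHom_Q, conjBy]
    refine cycp_hom_ext ?_ ?_
    · rw [← hP]
      change h.baseHom ((τ g)⁻¹ (CyCp.P p n)) = _
      cases g
      · rw [hτ.P_a, h.Pa, map_pow, h.baseHom_P]
      · rw [hτ.P_b, h.Pb, h.baseHom_P]
      · rw [hτ.P_c, h.Pc, map_mul, h.baseHom_P, h.baseHom_Q]
      · rw [hτ.P_d, h.Pd, map_inv, h.baseHom_P]
      · rw [hτ.P_e, h.Pe, map_zpow, h.baseHom_P]
      · rw [hτ.P_f, h.Pf, map_zpow, h.baseHom_P]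
    · rw [← hQ]
      change h.baseHom ((τ g)⁻¹ (CyCp.Q p n)) = _
      cases g
      · rw [hτ.Q_a, h.Qa, h.baseHom_Q]
      · rw [hτ.Q_b, h.Qb, map_mul, map_pow, h.baseHom_P, h.baseHom_Q]
      · rw [hτ.Q_c, h.Qc, h.baseHom_Q]
      · rw [hτ.Q_d, h.Qd, map_zpow, h.baseHom_Q]
      · rw [hτ.Q_e, h.Qe, map_zpow, h.baseHom_Q]
      · rw [hτ.Q_f, h.Qf, h.baseHom_Q]
  refine (DFunLike.congr_fun this z).trans ?_
  simp

/-- Reduces compatibility with the action of all automorphisms to the six generators, which is what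
the table supplies. -/
theorem closure_range_gen (Φ : AutPres p n s t ≃* K) :
    Subgroup.closure (Set.range fun g => Φ (gen p n s t g)) = ⊤ := by
  rw [eq_top_iff]
  rintro σ -
  have := PresentedGroup.generated_by (autRels p n s t)
    ((Subgroup.closure (Set.range fun g => Φ (gen p n s t g))).comap Φ.toMonoidHom)
    (fun g => Subgroup.subset_closure ⟨g, rfl⟩) (Φ.symm σ)
  simpa using this

/-- The presentation of the holomorph. -/
theorem exists_equiv_hol (Φ : AutPres p n s t ≃* MulAut (CyCp p n))
    (hΦ : IsTable p n x af yd ye (fun g => Φ (gen p n s t g))) :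
    ∃ Ψ : HolPres p n s t x af yd ye ≃* Hol (CyCp p n),
      ∀ g, Ψ (PresentedGroup.of g) = holGens Φ.toMonoidHom g := by
  have h := holPres_holds p n s t x af yd ye
  have hg : HolRelsHold p n s t x af yd ye (holGens Φ.toMonoidHom) := holGens_holds hΦ
  let F : HolPres p n s t x af yd ye →* Hol (CyCp p n) :=
    PresentedGroup.toGroup ((holRelsHold_iff _).2 hg)
  have hF : ∀ g, F (PresentedGroup.of g) = holGens Φ.toMonoidHom g := fun g =>
    PresentedGroup.toGroup.of _
  -- The relations of `autRels` hold among the last six generators, so the automorphism group maps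
  -- back through its own presentation.
  let A : MulAut (CyCp p n) →* HolPres p n s t x af yd ye :=
    (autLift h.aut).comp Φ.symm.toMonoidHom
  have hA : ∀ g, A (Φ (gen p n s t g)) = PresentedGroup.of (.aut g) := fun g => by
    simp [A]
  let F' : Hol (CyCp p n) →* HolPres p n s t x af yd ye :=
    SemidirectProduct.lift h.baseHom A
      (semidirect_compat _ _ (closure_range_gen Φ) (by
        rintro _ ⟨g, rfl⟩ z
        rw [hA]
        exact h.baseHom_conj hΦ g z))
  have hinl : ∀ z, F' (SemidirectProduct.inl z) = h.baseHom z := fun z =>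
    SemidirectProduct.lift_inl ..
  have hinr : ∀ z, F' (SemidirectProduct.inr z) = A z := fun z => SemidirectProduct.lift_inr ..
  have hF' : ∀ g, F' (holGens Φ.toMonoidHom g) = PresentedGroup.of g := by
    rintro (_ | _ | g)
    · exact (hinl _).trans h.baseHom_P
    · exact (hinl _).trans h.baseHom_Q
    · exact (hinr _).trans (hA g)
  have hFF' : ∀ g, F (F' (holGens Φ.toMonoidHom g)) = holGens Φ.toMonoidHom g := fun g => by
    rw [hF', hF]
  refine ⟨MonoidHom.toMulEquiv F F' ?_ ?_, hF⟩
  · exact PresentedGroup.ext fun g => (congrArg F' (hF g)).trans (hF' g)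
  · refine SemidirectProduct.hom_ext (cycp_hom_ext (hFF' .P) (hFF' .Q)) ?_
    refine MonoidHom.eq_of_eqOn_dense (closure_range_gen Φ) ?_
    rintro _ ⟨g, rfl⟩
    exact hFF' (.aut g)

end Holomorph

/-! ### Existence of the parameters and the table of the action. -/

section Parameters

variable {p n : ℕ} [hp : Fact p.Prime] [hn : Fact (1 < n)]

theorem exists_unit_of_orderOf_pos {M : Type} [Monoid M] {z : M} {N : ℕ} (hz : orderOf z = N)
    (hN : N ≠ 0) : ∃ u : Mˣ, (u : M) = z ∧ orderOf u = N := by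
  obtain ⟨u, rfl⟩ := IsUnit.of_pow_eq_one (pow_orderOf_eq_one z) (by rwa [hz])
  exact ⟨u, rfl, by rwa [orderOf_units] at hz⟩

theorem pow_prime_pow_units (u : (ZMod p)ˣ) (k : ℕ) : u ^ p ^ k = u :=
  Units.ext (by rw [Units.val_pow_eq_pow_val, ZMod.pow_card_pow])

theorem coprime_pred_prime_pow (p k : ℕ) [hp : Fact p.Prime] : (p - 1).Coprime (p ^ k) := by
  refine Nat.Coprime.pow_right k ?_
  have := Nat.coprime_self_sub_right hp.out.one_lt.le
  rw [Nat.coprime_comm, this]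
  exact Nat.coprime_one_right p

/-- If `r` is the order of the reduction, then `u ^ r` is congruent to `1`, so `p - 1` divides `r *
p ^ (n - 1)` and, by coprimality, `r`. -/
theorem orderOf_redUnits {u : (ZMod (p ^ n))ˣ} (hu : orderOf u = p - 1) :
    orderOf (redUnits p n u) = p - 1 := by
  refine Nat.dvd_antisymm (hu ▸ orderOf_map_dvd _ _) ?_
  have h1 : redUnits p n (u ^ orderOf (redUnits p n u)) = 1 := by
    rw [map_pow, pow_orderOf_eq_one]
  have h2 := pow_eq_one_of_redUnits_eq_one h1
  rw [← pow_mul] at h2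
  have h3 := orderOf_dvd_of_pow_eq_one h2
  rw [hu] at h3
  exact (coprime_pred_prime_pow p (n - 1)).dvd_of_dvd_mul_right h3

theorem natCast_mul_add_one :
    (((p - 1) * p ^ (n - 1) + 1 : ℕ) : ZMod (p ^ n)) = 1 - emb p n 1 := by
  have : (p - 1) * p ^ (n - 1) + 1 + p ^ (n - 1) = p ^ n + 1 := by
    rw [← prime_mul_pow_pred p n, Nat.sub_mul, one_mul]
    have := Nat.le_mul_of_pos_left (p ^ (n - 1)) hp.out.pos
    omega
  rw [emb_one, eq_sub_iff_add_eq, ← Nat.cast_add, this, Nat.cast_add, ZMod.natCast_self, zero_add,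
    Nat.cast_one]

variable {s t x af yd ye : ℤ}

theorem IsParam.exists_unitParam (h : IsParam p n s t x af yd ye) (hodd : Odd p) :
    ∃ us ux ua, UnitParam p n us ux ua s t ∧ (ux : ZMod (p ^ n)) = x ∧
      (ua : ZMod (p ^ n)) = af := by
  have hp1 : p - 1 ≠ 0 := Nat.sub_ne_zero_of_lt hp.out.one_lt
  obtain ⟨us, hus, hs⟩ := exists_unit_of_orderOf_pos h.s_order hp1
  obtain ⟨ux, hux, hx⟩ := exists_unit_of_orderOf_pos h.x_order hp1
  obtain ⟨ua, hua, ha⟩ := exists_unit_of_orderOf_pos h.af_order (pow_ne_zero _ hp.out.ne_zero)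
  refine ⟨us, ux, ua, ?_, hux, hua⟩
  exact
    { s_order := hs
      s_eq := hus.symm
      t_eq := by
        have : us ^ (p - 2) = us⁻¹ := by
          rw [eq_inv_iff_mul_eq_one, ← pow_succ]
          have : p - 2 + 1 = p - 1 := by have := hp.out.two_le; omega
          rw [this, ← hs, pow_orderOf_eq_one]
        rw [h.t_eq, ← hus, ← this, Units.val_pow_eq_pow_val]
      x_order := hx
      a_order := ha
      a_red := by
        -- By Fermat the `p ^ (n - 1)`-th power is the identity on units modulo `p`, whereas it
        -- kills `ua`.
        rw [← pow_prime_pow_units (redUnits p n ua) (n - 1), ← map_pow, ← ha, pow_orderOf_eq_one,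
          map_one]
      x_red_order := orderOf_redUnits hx
      a_pow := by
        rw [Units.val_pow_eq_pow_val, hua, h.af_pow, natCast_mul_add_one]
      even := Nat.Odd.sub_odd hodd odd_one }

/-- The normalised `p ^ (n - 1)`-th root of unity `1 - p`. -/
theorem one_sub_prime_spec (hp2 : p ≠ 2) :
    orderOf ((1 - p : ℤ) : ZMod (p ^ n)) = p ^ (n - 1) ∧
    ((1 - p : ℤ) : ZMod (p ^ n)) ^ p ^ (n - 2) =
      (((p - 1) * p ^ (n - 1) + 1 : ℕ) : ZMod (p ^ n)) := by
  constructor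
  · have h := ZMod.orderOf_one_add_mul_prime hp.out hp2 (-1)
      (fun h => hp.out.one_lt.ne' (by
        rw [dvd_neg] at h
        exact_mod_cast Int.eq_one_of_dvd_one (Int.natCast_nonneg p) h)) (n - 1)
    rw [Nat.sub_add_cancel hn.out.le] at h
    rw [← h]
    congr 1
    push_cast; ring
  · obtain ⟨y, hy⟩ := ZMod.exists_one_add_mul_pow_prime_pow_eq (R := ZMod (p ^ n)) (u := p) (v := p)
      hp.out dvd_rfl (by
        rw [← pow_two, ← pow_succ]
        exact pow_dvd_pow _ (by have := hp.out.two_le; omega)) (-1) (n - 2)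
    have h1 : n - 2 + 1 = n - 1 := by have := hn.out; omega
    have h2 : ((p : ZMod (p ^ n))) ^ (n - 1) * p = 0 := by
      rw [← pow_succ, Nat.sub_add_cancel hn.out.le, ← Nat.cast_pow, ZMod.natCast_self]
    rw [← pow_succ, h1] at hy
    have h3 : ((1 - p : ℤ) : ZMod (p ^ n)) = 1 + p * (-1) := by push_cast; ring
    rw [h3, hy, natCast_mul_add_one, emb_one, Nat.cast_pow]
    linear_combination y * h2

/-- For `x`, any lift of a primitive root modulo `p` is raised to the power `p ^ (n - 1)`: its
residue is unchanged by Fermat, and its order drops to a divisor of `p - 1` by Euler. -/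
theorem exists_isParam (hp2 : p ≠ 2) : ∃ s t x af yd ye : ℤ, IsParam p n s t x af yd ye := by
  have : NeZero (p ^ n) := ⟨pow_ne_zero _ hp.out.ne_zero⟩
  obtain ⟨g, hg⟩ := IsCyclic.exists_ofOrder_eq_natCard (α := (ZMod p)ˣ)
  rw [Nat.card_eq_fintype_card, ZMod.card_units] at hg
  obtain ⟨g', hg'⟩ := ZMod.unitsMap_surjective
    (dvd_pow_self p (Nat.ne_of_gt (Nat.zero_lt_of_lt hn.out))) g
  change redUnits p n g' = g at hg'
  have hred : redUnits p n (g' ^ p ^ (n - 1)) = g := by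
    rw [map_pow, hg', pow_prime_pow_units]
  have hx : orderOf (g' ^ p ^ (n - 1)) = p - 1 := by
    refine Nat.dvd_antisymm (orderOf_dvd_of_pow_eq_one ?_) ?_
    · rw [← pow_mul, ← Nat.totient_prime_pow hp.out (Nat.zero_lt_of_lt hn.out), ZMod.pow_totient]
    · rw [← hg]
      nth_rewrite 1 [← hred]
      exact orderOf_map_dvd _ _
  obtain ⟨s, hs⟩ := ZMod.intCast_surjective (g : ZMod p)
  obtain ⟨x, hx'⟩ := ZMod.intCast_surjective
    ((g' ^ p ^ (n - 1) : (ZMod (p ^ n))ˣ) : ZMod (p ^ n))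
  exact ⟨s, s ^ (p - 2), x, 1 - p, -s ^ (p - 2), x,
    { s_order := by rw [hs, orderOf_units, hg]
      t_eq := by push_cast; rfl
      x_order := by rw [hx', orderOf_units, hx]
      af_order := (one_sub_prime_spec hp2).1
      af_pow := (one_sub_prime_spec hp2).2
      yd_eq := by push_cast; rfl
      ye_eq := rfl }⟩

theorem isParam_three (n : ℕ) [hn : Fact (1 < n)] : IsParam 3 n (-1) (-1) (-1) (1 - 3) 1 (-1) := by
  have h1 : ((-1 : ℤ) : ZMod 3) ≠ 1 := by decide
  have h2 : ((-1 : ℤ) : ZMod 3) = ((-1 : ℤ) : ZMod 3) ^ (3 - 2) := by decide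
  have h3 : ((1 : ℤ) : ZMod 3) = -((-1 : ℤ) : ZMod 3) := by decide
  have : Fact (Nat.Prime 3) := ⟨Nat.prime_three⟩
  have order_two : ∀ m : ℕ, ((-1 : ℤ) : ZMod m) ≠ 1 → orderOf ((-1 : ℤ) : ZMod m) = 3 - 1 :=
    fun m hm => orderOf_eq_prime (p := 2) (by simp) hm
  have h := one_sub_prime_spec (p := 3) (n := n) (by decide)
  exact
    { s_order := order_two 3 h1
      t_eq := h2
      x_order := order_two (3 ^ n) fun hx => h1 (by
        rw [← red_intCast (n := n), hx, map_one])
      af_order := h.1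
      af_pow := h.2
      yd_eq := h3
      ye_eq := rfl }

theorem isTable_tau {us : (ZMod p)ˣ} {ux ua : (ZMod (p ^ n))ˣ}
    (hu : UnitParam p n us ux ua s t) (h : IsParam p n s t x af yd ye)
    (hux : (ux : ZMod (p ^ n)) = x) (hua : (ua : ZMod (p ^ n)) = af) :
    IsTable p n x af yd ye (fun g => (tau us ux ua g)⁻¹) := by
  have P_eq : CyCp.P p n = (.ofAdd 1, .ofAdd 0) := rfl
  have Q_eq : CyCp.Q p n = (.ofAdd 0, .ofAdd 1) := rfl
  exact
    { P_a := by
        rw [inv_inv, cycp_P_pow, natCast_mul_add_one, ← hu.a_pow]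
        exact endo_P ..
      Q_a := by
        rw [inv_inv]
        exact (endo_Q ..).trans (by rw [map_zero]; rfl)
      P_b := by
        rw [inv_inv]
        exact endo_P ..
      Q_b := by
        rw [inv_inv, cycp_P_pow, ← emb_one, Q_eq, Prod.mk_mul_mk, ofAdd_zero, ofAdd_zero, mul_one,
          one_mul]
        exact endo_Q ..
      P_c := by
        rw [inv_inv, P_eq, Q_eq, Prod.mk_mul_mk, ofAdd_zero, ofAdd_zero, mul_one, one_mul]
        exact endo_P ..
      Q_c := by
        rw [inv_inv]
        exact (endo_Q ..).trans (by rw [map_zero]; rfl)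
      P_d := by
        rw [inv_inv, ← zpow_neg_one, cycp_P_zpow]
        exact (endo_P ..).trans (by rw [Int.cast_neg, Int.cast_one]; rfl)
      Q_d := by
        rw [inv_inv, cycp_Q_zpow, h.yd_eq, hu.t_eq]
        exact (endo_Q ..).trans (by rw [map_zero, Units.val_neg])
      P_e := by
        rw [inv_inv, cycp_P_zpow, ← hux]
        exact endo_P ..
      Q_e := by
        rw [inv_inv, cycp_Q_zpow, h.ye_eq]
        exact (endo_Q ..).trans (by rw [map_zero, coe_redUnits, hux, red_intCast])
      P_f := by
        rw [inv_inv, cycp_P_zpow, ← hua]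
        exact endo_P ..
      Q_f := by
        rw [inv_inv]
        exact (endo_Q ..).trans (by rw [map_zero]; rfl) }

end Parameters
end HolAbelian

open HolAbelian

theorem mainTheorem3 (p n : ℕ) (hp : p.Prime) (hodd : Odd p) (hn : 1 < n) :
    -- parameters exist; for `p = 3` one may take `s = t = x = ye = -1` and `yd = 1`
    (∃ s t x af yd ye : ℤ, IsParam p n s t x af yd ye) ∧
    (p = 3 → ∃ af : ℤ, IsParam p n (-1) (-1) (-1) af 1 (-1)) ∧
    ∀ s t x af yd ye : ℤ, IsParam p n s t x af yd ye →
      -- the presentation of the automorphism group, with the action of its generators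
      ∃ Φ : PresentedGroup (autRels p n s t) ≃* MulAut (CyCp p n),
        IsTable p n x af yd ye (fun g => Φ (PresentedGroup.of g)) ∧
        -- `Aut(C_y × C_p) ≅ ((Qf(p) Y C_z) ⋊ C_{p-1}) × C_{p-1}`
        (∃ φ : Cyc (p - 1) →* MulAut (QfYC p n), IsQfYCAction p n s t φ ∧
          ∃ Θ : MulAut (CyCp p n) ≃* (QfYC p n ⋊[φ] Cyc (p - 1)) × Cyc (p - 1),
            ∀ g : AutGen, Θ (Φ (PresentedGroup.of g)) = gensOne p n φ g) ∧
        -- `Aut(C_y × C_p) ≅ ((Qf(p) ⋊ C_{p-1}) Y C_z) × C_{p-1}`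
        (∃ ψ : Cyc (p - 1) →* MulAut (Qf p), IsQfAction p s t ψ ∧
          ∃ Θ : MulAut (CyCp p n) ≃* QfCYC p n ψ × Cyc (p - 1),
            ∀ g : AutGen, Θ (Φ (PresentedGroup.of g)) = gensTwo p n ψ g) ∧
        -- the presentation of the holomorph
        (∃ Ψ : PresentedGroup (holRels p n s t x af yd ye) ≃* Hol (CyCp p n),
          Ψ (PresentedGroup.of HolGen.P) = SemidirectProduct.inl (CyCp.P p n) ∧
          Ψ (PresentedGroup.of HolGen.Q) = SemidirectProduct.inl (CyCp.Q p n) ∧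
          ∀ g : AutGen, Ψ (PresentedGroup.of (HolGen.aut g)) =
            SemidirectProduct.inr (Φ (PresentedGroup.of g))) := by
  have : Fact p.Prime := ⟨hp⟩
  have : Fact (1 < n) := ⟨hn⟩
  have hp2 : p ≠ 2 := by rintro rfl; exact absurd hodd (by decide)
  refine ⟨exists_isParam hp2, ?_, ?_⟩
  · rintro rfl
    exact ⟨_, isParam_three n⟩
  intro s t x af yd ye h
  obtain ⟨us, ux, ua, hu, hux, hua⟩ := h.exists_unitParam hodd
  have hs : us ^ (p - 1) = 1 := by rw [← hu.s_order, pow_orderOf_eq_one]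
  obtain ⟨φ, hφ⟩ := exists_isQfYCAction n hs hu.s_eq hu.t_eq
  obtain ⟨ψ, hψ⟩ := exists_isQfAction hs hu.s_eq hu.t_eq
  let Φ : AutPres p n s t ≃* MulAut (CyCp p n) :=
    MulEquiv.ofBijective (autHom hu) ⟨autHom_injective hu, autHom_surjective hu hp2⟩
  have hΦ : IsTable p n x af yd ye (fun g => Φ (gen p n s t g)) := by
    have : (fun g => Φ (gen p n s t g)) = fun g => (tau us ux ua g)⁻¹ :=
      funext fun g => autHom_gen hu g
    rw [this]
    exact isTable_tau hu h hux hua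
  obtain ⟨Θ₁, hΘ₁⟩ := exists_equiv_gensOne hφ
  obtain ⟨Θ₂, hΘ₂⟩ := exists_equiv_gensTwo (n := n) hψ
  obtain ⟨Ψ, hΨ⟩ := exists_equiv_hol Φ hΦ
  -- Both decompositions of the automorphism group pass back through the presented group, so the
  -- same `Φ` matches generators in all the claims.
  refine ⟨Φ, hΦ, ⟨φ, hφ, Φ.symm.trans Θ₁, fun g => ?_⟩, ⟨ψ, hψ, Φ.symm.trans Θ₂, fun g => ?_⟩,
    Ψ, hΨ _, hΨ _, fun g => hΨ _⟩
  · rw [MulEquiv.trans_apply, MulEquiv.symm_apply_apply]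
    exact hΘ₁ g
  · rw [MulEquiv.trans_apply, MulEquiv.symm_apply_apply]
    exact hΘ₂ g
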